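/- Let $T^r=(S^1)^r$ and let $\rho:T^r\to GL(n,\mathbb C)$ be a continuous homomorphism such that every $\rho$-invariant holomorphic function on $\mathbb C^n$ is constant. Let $D\subset\mathbb C^n$ be a bounded quasi-Reinhardt domain with respect to $\rho$, i.e. a bounded connected open set with $\rho(\lambda)D\subset D$ for all $\lambda\in T^r$, and assume $0\in D$. For $\mathbf k\in\mathbb Z^r$ let $V_{\mathbf k}$ be the space of square integrable holomorphic functions $\varphi$ on $D$ with $\varphi(\rho(\lambda)z)=\lambda^{\mathbf k}\varphi(z)$ for all $z\in D$, $\lambda\in T^r$, where $\lambda^{\mathbf k}=\lambda_1^{k_1}\cdots\lambda_r^{k_r}$. Each $V_{\mathbf k}$ is a finite-dimensional space of polynomials; if $V_{\mathbf k}\neq 0$, let $d_{\mathbf k}$ and $D_{\mathbf k}$ be the minimum and the maximum of the degrees of its nonzero elements. Below, $\mathbf k$ ranges over the elements of $\mathbb Z^r$ with $V_{\mathbf k}\ne0$. Put $$\mu_\rho=\max\{D_{\mathbf k}:\ d_{\mathbf k}=1\},\qquad \nu_\rho=\max\{D_{\mathbf k}:\ d_{\mathbf k}\le\mu_\rho\}$$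 (with $\mu_\rho=0$ if $n=0$). There are linear coordinates $z=(z_1,\dots,z_n)$ on $\mathbb C^n$ and $\mathbf a_1,\dots,\mathbf a_n\in\mathbb Z^r$ with $\rho(\lambda)z=(\lambda^{\mathbf a_1}z_1,\dots,\lambda^{\mathbf a_n}z_n)$ for all $\lambda\in T^r$; for any such coordinates and $1\le i\le n$ put $$\mu_i=\max\{\alpha_1+\cdots+\alpha_n:\ \alpha\in\mathbb N^n,\ \alpha_1\mathbf a_1+\cdots+\alpha_n\mathbf a_n=\mathbf a_i\},\qquad \nu_i=\max\{D_{\mathbf k}:\ d_{\mathbf k}\le\mu_i\}.$$ Let $f$ be a holomorphic automorphism of $D$ with $f(0)=0$. Then $f$ is (the restriction to $D$ of) a polynomial map. In any coordinates as above, the $i$-th component $f_i$ of $f$ is a polynomial with $\deg f_i\le\nu_i$ for $1\le i\le n$; moreover $\deg f=\max_i\deg f_i\le\nu_\rho$. -/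

import Mathlib

open MeasureTheory

noncomputable section

namespace QuasiReinhardt

/-- The torus `T^r = (S¹)^r`. -/
abbrev Torus (r : ℕ) : Type := Fin r → Circle

/-- The character `t ↦ t^k = t₁^{k₁} ⋯ t_r^{k_r}` of `T^r`, for `k ∈ ℤ^r`. -/
def torusChar {r : ℕ} (k : Fin r → ℤ) (t : Torus r) : ℂ :=
  ∏ j, (t j : ℂ) ^ (k j)

/-- The linear action `(t, z) ↦ ρ(t) z` of `T^r` on `ℂ^n` given by `ρ : T^r → GL(n, ℂ)`. -/
def act {r n : ℕ} (ρ : Torus r →* Matrix.GeneralLinearGroup (Fin n) ℂ)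
    (t : Torus r) (z : Fin n → ℂ) : Fin n → ℂ :=
  (ρ t : Matrix (Fin n) (Fin n) ℂ).mulVec z

/-- `𝒪(ℂ^n)^ρ = ℂ`: every `ρ`-invariant entire function on `ℂ^n` is constant. -/
def OnlyConstantInvariants {r n : ℕ}
    (ρ : Torus r →* Matrix.GeneralLinearGroup (Fin n) ℂ) : Prop :=
  ∀ φ : (Fin n → ℂ) → ℂ, Differentiable ℂ φ →
    (∀ (t : Torus r) (z : Fin n → ℂ), φ (act ρ t z) = φ z) → ∃ c : ℂ, ∀ z, φ z = c

/-- `D` is a domain (open and connected, in particular nonempty) of `ℂ^n` that is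
`ρ`-invariant. -/
structure IsQuasiReinhardt {r n : ℕ}
    (ρ : Torus r →* Matrix.GeneralLinearGroup (Fin n) ℂ) (D : Set (Fin n → ℂ)) : Prop where
  isOpen : IsOpen D
  isConnected : IsConnected D
  invariant : ∀ (t : Torus r), ∀ z ∈ D, act ρ t z ∈ D

/-- `f` restricts to a holomorphic automorphism of `D`: it maps `D` holomorphically into `D`
and has a holomorphic two-sided inverse there. -/
def IsAutomorphism {n : ℕ} (D : Set (Fin n → ℂ)) (f : (Fin n → ℂ) → (Fin n → ℂ)) : Prop :=
  DifferentiableOn ℂ f D ∧ Set.MapsTo f D D ∧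
    ∃ g : (Fin n → ℂ) → (Fin n → ℂ),
      DifferentiableOn ℂ g D ∧ Set.MapsTo g D D ∧ Set.InvOn g f D D

/-- The weight space `V_k`: the square integrable holomorphic functions `φ` on `D` with
`φ(ρ(t) z) = t^k φ(z)`.  Only the values of `φ` on `D` matter. -/
def weightSpace {r n : ℕ} (ρ : Torus r →* Matrix.GeneralLinearGroup (Fin n) ℂ)
    (D : Set (Fin n → ℂ)) (k : Fin r → ℤ) : Set ((Fin n → ℂ) → ℂ) :=
  {φ | DifferentiableOn ℂ φ D ∧ MemLp φ 2 (volume.restrict D) ∧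
    ∀ (t : Torus r), ∀ z ∈ D, φ (act ρ t z) = torusChar k t * φ z}

/-- The degrees of the nonzero elements of `V_k`, which are polynomials on `D`. -/
def weightDegrees {r n : ℕ} (ρ : Torus r →* Matrix.GeneralLinearGroup (Fin n) ℂ)
    (D : Set (Fin n → ℂ)) (k : Fin r → ℤ) : Set ℕ :=
  {m | ∃ p : MvPolynomial (Fin n) ℂ, p ≠ 0 ∧
    (fun z => MvPolynomial.eval z p) ∈ weightSpace ρ D k ∧ p.totalDegree = m}

/-- `d_k`, the minimal degree of a nonzero element of `V_k`
(used only where `V_k ≠ 0`). -/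
def minDeg {r n : ℕ} (ρ : Torus r →* Matrix.GeneralLinearGroup (Fin n) ℂ)
    (D : Set (Fin n → ℂ)) (k : Fin r → ℤ) : ℕ :=
  sInf (weightDegrees ρ D k)

/-- `D_k`, the maximal degree of a nonzero element of `V_k`. The value of `sSup` at an unbounded
set of naturals is `0`, so here and below it can only make an upper bound by it stronger. -/
def maxDeg {r n : ℕ} (ρ : Torus r →* Matrix.GeneralLinearGroup (Fin n) ℂ)
    (D : Set (Fin n → ℂ)) (k : Fin r → ℤ) : ℕ :=
  sSup (weightDegrees ρ D k)

/-- The resonance order `μ_ρ = max {D_k ; V_k ≠ 0, d_k = 1}`. -/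
def resonanceOrder {r n : ℕ} (ρ : Torus r →* Matrix.GeneralLinearGroup (Fin n) ℂ)
    (D : Set (Fin n → ℂ)) : ℕ :=
  sSup {m | ∃ k : Fin r → ℤ, (weightDegrees ρ D k).Nonempty ∧ minDeg ρ D k = 1 ∧
    maxDeg ρ D k = m}

/-- `max {D_k ; V_k ≠ 0, d_k ≤ μ}`. -/
def maxDegUpTo {r n : ℕ} (ρ : Torus r →* Matrix.GeneralLinearGroup (Fin n) ℂ)
    (D : Set (Fin n → ℂ)) (μ : ℕ) : ℕ :=
  sSup {m | ∃ k : Fin r → ℤ, (weightDegrees ρ D k).Nonempty ∧ minDeg ρ D k ≤ μ ∧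
    maxDeg ρ D k = m}

/-- The quasi-resonance order `ν_ρ = max {D_k ; d_k ≤ μ_ρ}`. -/
def quasiResonanceOrder {r n : ℕ} (ρ : Torus r →* Matrix.GeneralLinearGroup (Fin n) ℂ)
    (D : Set (Fin n → ℂ)) : ℕ :=
  maxDegUpTo ρ D (resonanceOrder ρ D)

/-- In the linear coordinates of `ℂ^n` given by the basis `b`, the action is
`ρ(t) z = (t^{a_1} z_1, …, t^{a_n} z_n)`. -/
def IsWeightBasis {r n : ℕ} (ρ : Torus r →* Matrix.GeneralLinearGroup (Fin n) ℂ)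
    (b : Module.Basis (Fin n) ℂ (Fin n → ℂ)) (a : Fin n → Fin r → ℤ) : Prop :=
  ∀ (t : Torus r) (i : Fin n), act ρ t (b i) = torusChar (a i) t • b i

/-- The `i`-th resonance set
`E_i = {α ∈ ℕ^n ; α_1 a_{1j} + ⋯ + α_n a_{nj} = a_{ij} for all j}`. -/
def resonanceSet {r n : ℕ} (a : Fin n → Fin r → ℤ) (i : Fin n) : Set (Fin n → ℕ) :=
  {α | ∀ j : Fin r, ∑ l, (α l : ℤ) * a l j = a i j}

/-- The `i`-th resonance order `μ_i = max {|α| ; α ∈ E_i}`. -/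
def resonanceOrderAt {r n : ℕ} (a : Fin n → Fin r → ℤ) (i : Fin n) : ℕ :=
  sSup {m | ∃ α ∈ resonanceSet a i, ∑ l, α l = m}

/-- The `i`-th quasi-resonance order `ν_i = max {D_k ; d_k ≤ μ_i}`. -/
def quasiResonanceOrderAt {r n : ℕ} (ρ : Torus r →* Matrix.GeneralLinearGroup (Fin n) ℂ)
    (D : Set (Fin n → ℂ)) (a : Fin n → Fin r → ℤ) (i : Fin n) : ℕ :=
  maxDegUpTo ρ D (resonanceOrderAt a i)

end QuasiReinhardt

end

/-! In suitable coordinates `ρ` is diagonal, so each monomial `z^α` has a weight `∑ α_l a_l`. A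
monomial of weight `0` is invariant, hence constant by hypothesis; so only `α = 0` has weight `0`.
Two distinct exponents of equal weight are then incomparable, and Dickson's lemma leaves finitely
many monomials of each weight. Averaging against a character of the torus cuts a holomorphic
function on `D` into weight components, and each component is a polynomial spanned by these
monomials.

The action preserves volume on `D`, so distinct weights are orthogonal in `L²(D)`. For the weight
`0` this gives the mean value property `∫_D φ = vol(D) φ(0)`. Let `g` be the inverse of `f`. The
mean value property, used on `D` before and after the change of variables `z = g(w)`, shows that the
Jacobian `J_f` is constant (`jacobian_eq_const`). Hence composition with `f` is unitary up to a
constant factor.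

The crux is `weightPart_component_eq_zero`. For `ψ` of weight `k`, `⟨f_i, ψ⟩` is a multiple of
`⟨z_i, ψ ∘ g⟩`, which sees only the part of `ψ ∘ g` of weight `a_i`. If `d_k > μ_i`, then `ψ`, and
so `ψ ∘ g` and its part of weight `a_i`, vanish at `0` to order greater than `μ_i`; but polynomials
of weight `a_i` have degree at most `μ_i`, so that part is zero. Thus `f_i` has components only in
the finitely many weights with `d_k ≤ μ_i`, each of degree at most `D_k ≤ ν_i`, and Fourier
uniqueness on the torus makes `f_i` their sum. Finally `μ_i ≤ μ_ρ` because `d_{a_i} = 1`. -/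

namespace QuasiReinhardt

/-! ### Holomorphic functions of several variables. -/

section SeveralVariables

open Metric Set Filter Topology

variable {E : Type*} [NormedAddCommGroup E] [NormedSpace ℂ E]

/-- Cauchy estimate: a bounded holomorphic function on a ball is Lipschitz on the half ball. -/
theorem lipschitzOnWith_of_bounded {φ : E → ℂ} {z₀ : E} {R M : ℝ} (hR : 0 < R)
    (hd : DifferentiableOn ℂ φ (ball z₀ R)) (hM : ∀ z ∈ ball z₀ R, ‖φ z‖ ≤ M) :
    LipschitzOnWith (Real.nnabs (2 * M / (R / 2))) φ (ball z₀ (R / 2)) := by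
  have hsub : ∀ z ∈ ball z₀ (R / 2), ball z (R / 2) ⊆ ball z₀ R := by
    intro z hz
    apply ball_subset_ball'
    rw [mem_ball] at hz
    linarith
  refine (convex_ball z₀ (R / 2)).lipschitzOnWith_of_nnnorm_fderiv_le (𝕜 := ℂ) ?_ ?_
  · intro z hz
    refine hd.differentiableAt (isOpen_ball.mem_nhds ?_)
    exact hsub z hz (mem_ball_self (by positivity))
  · intro z hz
    -- `2 * M` bounds `φ y - φ z`; a ball of radius `R / 2` about `z` still lies in the large ball.
    have h1 : ‖fderiv ℂ φ z‖ ≤ 2 * M / (R / 2) := by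
      refine Complex.norm_fderiv_le_div_of_mapsTo_ball (hd.mono (hsub z hz)) ?_ (by positivity)
      intro y hy
      rw [mem_closedBall, dist_eq_norm]
      have h2 := hM y (hsub z hz hy)
      have h3 := hM z (hsub z hz (mem_ball_self (by positivity)))
      linarith [norm_sub_le (φ y) (φ z)]
    rw [← NNReal.coe_le_coe, coe_nnnorm, Real.coe_nnabs]
    exact h1.trans (le_abs_self _)

/-- Differentiation under the integral sign for a bounded family of holomorphic functions. -/
theorem differentiableAt_integral_of_bounded [FiniteDimensional ℂ E] {X : Type*} [MeasurableSpace X] {μ : Measure X}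
    [IsFiniteMeasure μ] {F : E → X → ℂ} {z₀ : E} {R M : ℝ} (hR : 0 < R)
    (hmeas : ∀ z ∈ ball z₀ R, AEStronglyMeasurable (F z) μ)
    (hd : ∀ x, DifferentiableOn ℂ (fun z => F z x) (ball z₀ R))
    (hM : ∀ z ∈ ball z₀ R, ∀ x, ‖F z x‖ ≤ M) :
    DifferentiableAt ℂ (fun z => ∫ x, F z x ∂μ) z₀ := by
  have hz₀ : z₀ ∈ ball z₀ R := mem_ball_self hR
  have hda : ∀ x, HasFDerivAt (fun z => F z x) (fderiv ℂ (fun z => F z x) z₀) z₀ := fun x =>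
    ((hd x).differentiableAt (isOpen_ball.mem_nhds hz₀)).hasFDerivAt
  -- Directional derivatives are limits of measurable difference quotients; finitely many of them
  -- rebuild the whole derivative in `hF'`.
  have hdir : ∀ v : E, AEStronglyMeasurable (fun x => fderiv ℂ (fun z => F z x) z₀ v) μ := by
    intro v
    have hc : Tendsto (fun m : ℕ => ‖(m : ℂ)‖) atTop atTop := by
      simpa using tendsto_natCast_atTop_atTop (R := ℝ)
    have hlim : ∀ x, Tendsto (fun m : ℕ => (m : ℂ) • (F (z₀ + (m : ℂ)⁻¹ • v) x - F z₀ x)) atTop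
        (𝓝 (fderiv ℂ (fun z => F z x) z₀ v)) := fun x => (hda x).lim v hc
    have hball : ∀ᶠ m : ℕ in atTop, z₀ + (m : ℂ)⁻¹ • v ∈ ball z₀ R := by
      have h1 : Tendsto (fun m : ℕ => z₀ + (m : ℂ)⁻¹ • v) atTop (𝓝 (z₀ + (0 : ℂ) • v)) :=
        tendsto_const_nhds.add ((tendsto_inv_atTop_nhds_zero_nat (𝕜 := ℂ)).smul_const v)
      rw [zero_smul, add_zero] at h1
      exact h1.eventually (isOpen_ball.mem_nhds hz₀)
    obtain ⟨N, hN⟩ := eventually_atTop.1 hball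
    refine aestronglyMeasurable_of_tendsto_ae atTop
      (f := fun m : ℕ => fun x =>
        ((m + N : ℕ) : ℂ) • (F (z₀ + ((m + N : ℕ) : ℂ)⁻¹ • v) x - F z₀ x))
      (fun m => ?_) (Eventually.of_forall fun x => ?_)
    · exact ((hmeas _ (hN _ (Nat.le_add_left N m))).sub (hmeas _ hz₀)).const_smul
        ((m + N : ℕ) : ℂ)
    · exact (hlim x).comp (tendsto_add_atTop_nat N)
  have hF' : AEStronglyMeasurable (fun x => fderiv ℂ (fun z => F z x) z₀) μ := by
    let b := Module.finBasis ℂ E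
    have heq : (fun x => fderiv ℂ (fun z => F z x) z₀) = fun x =>
        ∑ i, fderiv ℂ (fun z => F z x) z₀ (b i) • (b.coord i).toContinuousLinearMap := by
      funext x
      ext v
      conv_lhs => rw [← b.sum_repr v]
      simp [-Module.Basis.sum_repr, map_sum, mul_comm]
    rw [heq]
    exact Finset.aestronglyMeasurable_fun_sum _ fun i _ => (hdir (b i)).smul_const _
  refine (hasFDerivAt_integral_of_dominated_loc_of_lip (𝕜 := ℂ)
    (s := ball z₀ (R / 2)) (bound := fun _ => 2 * M / (R / 2))
    (ball_mem_nhds _ (by positivity)) ?_ ?_ hF' ?_ (integrable_const _)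
    (Eventually.of_forall hda)).2.differentiableAt
  · filter_upwards [isOpen_ball.mem_nhds hz₀] with z hz using hmeas z hz
  · exact Integrable.of_bound (hmeas _ hz₀) M (Eventually.of_forall (hM _ hz₀))
  · exact Eventually.of_forall fun x =>
      lipschitzOnWith_of_bounded hR (hd x) (fun z hz => hM z hz x)

theorem exists_closedBall_bound [FiniteDimensional ℂ E] {φ : E → ℂ} {U : Set E} (hU : IsOpen U)
    (hφ : ContinuousOn φ U) {z₀ : E} (hz₀ : z₀ ∈ U) :
    ∃ R > 0, ∃ M, closedBall z₀ R ⊆ U ∧ ∀ z ∈ closedBall z₀ R, ‖φ z‖ ≤ M := by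
  obtain ⟨R, hR, hRU⟩ := nhds_basis_closedBall.mem_iff.1 (hU.mem_nhds hz₀)
  have : ProperSpace E := FiniteDimensional.proper ℂ E
  obtain ⟨M, hM⟩ := (isCompact_closedBall z₀ R).exists_bound_of_continuousOn (hφ.mono hRU)
  exact ⟨R, hR, M, hRU, hM⟩

/-- Directional derivatives of holomorphic functions are holomorphic. -/
theorem differentiableOn_fderiv_apply [FiniteDimensional ℂ E] {φ : E → ℂ} {U : Set E} (hU : IsOpen U)
    (hφ : DifferentiableOn ℂ φ U) (v : E) :
    DifferentiableOn ℂ (fun z => fderiv ℂ φ z v) U := by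
  intro z₀ hz₀
  apply DifferentiableAt.differentiableWithinAt
  obtain ⟨R, hR, M, hRU, hM⟩ := exists_closedBall_bound hU hφ.continuousOn hz₀
  -- Small enough that `s * ‖v‖ ≤ R / 2`; the `+ 1` covers `v = 0`.
  set s : ℝ := R / (2 * (‖v‖ + 1)) with hs
  have hs0 : 0 < s := by positivity
  have hsv : s * ‖v‖ ≤ R / 2 := by
    rw [hs, div_mul_eq_mul_div, div_le_iff₀ (by positivity)]
    nlinarith [norm_nonneg v]
  have hmem : ∀ z ∈ ball z₀ (R / 2), ∀ ζ ∈ closedBall (0 : ℂ) s, z + ζ • v ∈ closedBall z₀ R := by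
    intro z hz ζ hζ
    rw [mem_ball, dist_eq_norm] at hz
    rw [mem_closedBall, dist_zero_right] at hζ
    rw [mem_closedBall, dist_eq_norm]
    have h1 : ‖ζ • v‖ ≤ R / 2 := by
      rw [norm_smul]
      exact (mul_le_mul_of_nonneg_right hζ (norm_nonneg v)).trans hsv
    calc ‖z + ζ • v - z₀‖ = ‖(z - z₀) + ζ • v‖ := by congr 1; abel
      _ ≤ ‖z - z₀‖ + ‖ζ • v‖ := norm_add_le _ _
      _ ≤ R := by linarith
  -- Integrand of Cauchy's formula for the derivative at `0` of `ζ ↦ φ (z + ζ • v)`. It depends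
  -- holomorphically on `z`.
  let F : E → ℝ → ℂ := fun z θ =>
    deriv (circleMap 0 s) θ • (((circleMap 0 s θ - 0) ^ 2)⁻¹ • φ (z + circleMap 0 s θ • v))
  have hcm : ∀ θ, circleMap (0 : ℂ) s θ ∈ closedBall (0 : ℂ) s := fun θ =>
    circleMap_mem_closedBall 0 hs0.le θ
  have hcn : ∀ θ, ‖circleMap (0 : ℂ) s θ‖ = s := fun θ => by simp [abs_of_pos hs0]
  have key : ∀ z ∈ ball z₀ (R / 2), fderiv ℂ φ z v =
      (2 * Real.pi * Complex.I : ℂ)⁻¹ •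
        ∫ θ, F z θ ∂(volume.restrict (Ioc 0 (2 * Real.pi))) := by
    intro z hz
    have hzU : z ∈ U := hRU (by simpa using hmem z hz 0 (mem_closedBall_self hs0.le))
    have hline : ∀ ζ : ℂ, HasFDerivAt (fun ζ : ℂ => z + ζ • v)
        ((ContinuousLinearMap.id ℂ ℂ).smulRight v) ζ := fun ζ => by
      simpa using ((hasFDerivAt_id (𝕜 := ℂ) ζ).smul_const v).const_add z
    have hV : IsOpen ((fun ζ : ℂ => z + ζ • v) ⁻¹' U) := hU.preimage (by fun_prop)
    have hdiff : DifferentiableOn ℂ (fun ζ : ℂ => φ (z + ζ • v))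
        ((fun ζ : ℂ => z + ζ • v) ⁻¹' U) := by
      refine hφ.comp (fun ζ _ => (hline ζ).differentiableAt.differentiableWithinAt) ?_
      exact fun ζ hζ => hζ
    have h1 := Complex.two_pi_I_inv_smul_circleIntegral_sub_sq_inv_smul_of_differentiable
      (c := (0 : ℂ)) (R := s) (w₀ := 0) hV (fun ζ hζ => hRU (hmem z hz ζ hζ)) hdiff
      (mem_ball_self hs0)
    have h2 : deriv (fun ζ : ℂ => φ (z + ζ • v)) 0 = fderiv ℂ φ z v := by
      have h3 : HasFDerivAt φ (fderiv ℂ φ z) (z + (0 : ℂ) • v) := by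
        rw [zero_smul, add_zero]
        exact (hφ.differentiableAt (hU.mem_nhds hzU)).hasFDerivAt
      have h4 := (h3.comp (0 : ℂ) (hline 0)).hasDerivAt.deriv
      simpa [Function.comp_def] using h4
    rw [h2] at h1
    rw [← h1, circleIntegral, intervalIntegral.integral_of_le (by positivity)]
  have hdF : DifferentiableAt ℂ
      (fun z => ∫ θ, F z θ ∂(volume.restrict (Ioc 0 (2 * Real.pi)))) z₀ := by
    refine differentiableAt_integral_of_bounded (R := R / 2) (M := s * ((s ^ 2)⁻¹ * M))
      (by positivity) ?_ ?_ ?_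
    · intro z hz
      apply Continuous.aestronglyMeasurable
      have h1 : Continuous fun θ : ℝ => φ (z + circleMap 0 s θ • v) := by
        refine ContinuousOn.comp_continuous hφ.continuousOn ?_ fun θ => hRU (hmem z hz _ (hcm θ))
        exact continuous_const.add ((continuous_circleMap 0 s).smul continuous_const)
      have h2 : Continuous fun θ : ℝ => ((circleMap 0 s θ - 0) ^ 2)⁻¹ := by
        refine Continuous.inv₀ (((continuous_circleMap 0 s).sub continuous_const).pow 2) ?_
        intro θ h
        have := hcn θ
        simp only [sub_zero, pow_eq_zero_iff, ne_eq, OfNat.ofNat_ne_zero, not_false_eq_true] at h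
        rw [h, norm_zero] at this
        exact hs0.ne this
      have h3 : Continuous fun θ : ℝ => deriv (circleMap 0 s) θ := by
        simp only [deriv_circleMap]
        exact (continuous_circleMap 0 s).mul continuous_const
      exact h3.smul (h2.smul h1)
    · intro θ
      have h1 : DifferentiableOn ℂ (fun z => φ (z + circleMap 0 s θ • v)) (ball z₀ (R / 2)) :=
        hφ.comp (by fun_prop) fun z hz => hRU (hmem z hz _ (hcm θ))
      exact (h1.const_smul ((circleMap 0 s θ - 0) ^ 2)⁻¹).const_smul (deriv (circleMap 0 s) θ)
    · intro z hz θ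
      simp only [F, norm_smul, deriv_circleMap, norm_mul, Complex.norm_I, mul_one, sub_zero,
        norm_inv, norm_pow, hcn]
      gcongr
      exact hM _ (hmem z hz _ (hcm θ))
  refine (hdF.const_smul (2 * Real.pi * Complex.I : ℂ)⁻¹).congr_of_eventuallyEq ?_
  filter_upwards [ball_mem_nhds z₀ (half_pos hR)] with z hz using key z hz

/-- Holomorphic functions are infinitely differentiable. -/
theorem contDiffOn_of_differentiableOn [FiniteDimensional ℂ E] {φ : E → ℂ} {U : Set E} (hU : IsOpen U)
    (hφ : DifferentiableOn ℂ φ U) (m : ℕ) : ContDiffOn ℂ m φ U := by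
  induction m generalizing φ with
  | zero => simpa using hφ.continuousOn
  | succ m ih =>
    rw [show ((m + 1 : ℕ) : WithTop ℕ∞) = m + 1 by norm_cast,
      contDiffOn_succ_iff_fderiv_of_isOpen hU]
    refine ⟨hφ, by simp, ?_⟩
    rw [contDiffOn_clm_apply]
    exact fun v => ih (differentiableOn_fderiv_apply hU hφ v)

/-- The identity theorem for holomorphic functions on a domain. -/
theorem eqOn_zero_of_eventuallyEq_zero {φ : E → ℂ} {U : Set E} (hU : IsOpen U)
    (hc : IsPreconnected U) (hφ : DifferentiableOn ℂ φ U) {z₀ : E} (hz₀ : z₀ ∈ U)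
    (h : φ =ᶠ[𝓝 z₀] 0) : EqOn φ 0 U := by
  have hsub : U ⊆ {z | φ =ᶠ[𝓝 z] 0} := by
    refine hc.subset_of_closure_inter_subset (isOpen_setOfPred_eventually_nhds) ⟨z₀, hz₀, h⟩ ?_
    rintro z₁ ⟨hcl, hz₁⟩
    obtain ⟨ε, hε, hball⟩ := Metric.isOpen_iff.1 hU z₁ hz₁
    obtain ⟨s, hs, hsz⟩ := Metric.mem_closure_iff.1 hcl ε hε
    have hsb : s ∈ ball z₁ ε := by rwa [mem_ball, dist_comm]
    filter_upwards [ball_mem_nhds z₁ hε] with y hy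
    -- The complex line with `g 0 = s` and `g 1 = y`: its part in the ball is convex, so the
    -- one-variable identity theorem carries the vanishing from `s` to `y`.
    let g : ℂ → E := fun τ => s + τ • (y - s)
    have hg : Differentiable ℂ g := by fun_prop
    have hVc : Convex ℝ (g ⁻¹' ball z₁ ε) := by
      intro τ hτ σ hσ p q hp hq hpq
      have : g (p • τ + q • σ) = p • g τ + q • g σ := by
        have h1 : (p : ℂ) + q = 1 := by exact_mod_cast hpq
        have h2 : (q : ℂ) = 1 - p := by rw [← h1]; ring
        simp only [g, ← Complex.coe_smul, h2, smul_eq_mul]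
        module
      rw [mem_preimage, this]
      exact (convex_ball z₁ ε) hτ hσ hp hq hpq
    have hVo : IsOpen (g ⁻¹' ball z₁ ε) := isOpen_ball.preimage hg.continuous
    have hd : DifferentiableOn ℂ (φ ∘ g) (g ⁻¹' ball z₁ ε) :=
      hφ.comp hg.differentiableOn fun τ hτ => hball hτ
    have h0 : (φ ∘ g) =ᶠ[𝓝 0] 0 := by
      have : Tendsto g (𝓝 0) (𝓝 s) := by
        simpa [g] using (hg.continuous.tendsto 0)
      exact this.eventually hs
    have := (hd.analyticOnNhd hVo).eqOn_zero_of_preconnected_of_eventuallyEq_zero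
      hVc.isPreconnected (z₀ := 0) (by simpa [g] using hsb) h0
    simpa [g] using this (show (1 : ℂ) ∈ g ⁻¹' ball z₁ ε by simpa [g] using hy)
  exact fun z hz => (hsub hz).self_of_nhds

/-- The Taylor expansion of a holomorphic function by homogeneous forms; the form of degree `m`
is also the `m`-th Taylor coefficient along complex lines through the origin. -/
theorem exists_hasSum_homogeneous [FiniteDimensional ℂ E] {φ : E → ℂ} {R : ℝ}
    (hφ : DifferentiableOn ℂ φ (ball 0 R)) :
    ∃ p : (m : ℕ) → ContinuousMultilinearMap ℂ (fun _ : Fin m => E) ℂ,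
      (∀ z ∈ ball (0 : E) R, HasSum (fun m => p m fun _ => z) (φ z)) ∧
      ∀ m z, 0 < R → (p m fun _ => z) =
        (m.factorial : ℂ)⁻¹ * iteratedDeriv m (fun s : ℂ => φ (s • z)) 0 := by
  have key : ∀ m z, 0 < R →
      iteratedDeriv m (fun s : ℂ => φ (s • z)) 0 = iteratedFDeriv ℂ m φ 0 fun _ => z := by
    intro m z hR
    let g : ℂ →L[ℂ] E := (ContinuousLinearMap.id ℂ ℂ).smulRight z
    have hV : IsOpen (g ⁻¹' ball 0 R) := isOpen_ball.preimage g.continuous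
    have h0 : (0 : ℂ) ∈ g ⁻¹' ball 0 R := by simpa using hR
    have h1 := g.iteratedFDerivWithin_comp_right (contDiffOn_of_differentiableOn isOpen_ball hφ m)
      isOpen_ball.uniqueDiffOn hV.uniqueDiffOn (x := 0) (by simpa using hR) le_rfl
    rw [iteratedFDerivWithin_of_isOpen m hV h0,
      iteratedFDerivWithin_of_isOpen m isOpen_ball (by simpa using hR)] at h1
    rw [iteratedDeriv_eq_iteratedFDeriv]
    have h2 := congrArg (fun T => T fun _ => (1 : ℂ)) h1
    simpa [g, Function.comp_def] using h2
  refine ⟨fun m => (m.factorial : ℂ)⁻¹ • iteratedFDeriv ℂ m φ 0, fun z hz => ?_,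
    fun m z hR => by simp [key m z hR]⟩
  have hR : 0 < R := pos_of_mem_ball hz
  have hzR : ‖z‖ < R := by simpa using hz
  -- With `t > 1` the point `1` is interior to the disc on which `s ↦ φ (s • z)` is expanded.
  obtain ⟨t, ht1, ht⟩ : ∃ t : ℝ, 1 < t ∧ t * ‖z‖ < R := by
    rcases eq_or_lt_of_le (norm_nonneg z) with h | h
    · exact ⟨2, one_lt_two, by rw [← h]; simpa using hR⟩
    · obtain ⟨t, h1, h2⟩ := exists_between ((one_lt_div h).2 hzR)
      exact ⟨t, h1, (lt_div_iff₀ h).1 h2⟩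
  have hd : DifferentiableOn ℂ (fun s : ℂ => φ (s • z)) (ball 0 t) := by
    refine hφ.comp (by fun_prop) fun s hs => ?_
    simp only [mem_ball, dist_zero_right, norm_smul] at hs ⊢
    exact lt_of_le_of_lt (mul_le_mul_of_nonneg_right hs.le (norm_nonneg z)) ht
  have h3 := Complex.hasSum_taylorSeries_on_ball hd (z := 1) (by simpa using ht1)
  simpa [key _ z hR] using h3

end SeveralVariables

/-! ### Fourier analysis on the torus. -/

noncomputable instance : MeasurableSpace Circle := borel Circle

instance : BorelSpace Circle := ⟨rfl⟩

/-- The normalized Haar measure of the torus. -/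
noncomputable def torusHaar (r : ℕ) : Measure (Torus r) := Measure.haarMeasure ⊤

section TorusCharacters

variable {r : ℕ}

instance : IsProbabilityMeasure (torusHaar r) :=
  ⟨by
    have := Measure.haarMeasure_self (K₀ := (⊤ : TopologicalSpace.PositiveCompacts (Torus r)))
    simpa [torusHaar] using this⟩

instance : (torusHaar r).IsMulLeftInvariant := by unfold torusHaar; infer_instance

instance : (torusHaar r).IsOpenPosMeasure := by unfold torusHaar; infer_instance

theorem torusChar_mul (k : Fin r → ℤ) (s t : Torus r) :
    torusChar k (s * t) = torusChar k s * torusChar k t := by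
  simp [torusChar, mul_zpow, Finset.prod_mul_distrib]

theorem torusChar_add (k l : Fin r → ℤ) (t : Torus r) :
    torusChar (k + l) t = torusChar k t * torusChar l t := by
  simp [torusChar, ← Finset.prod_mul_distrib, zpow_add₀]

@[simp]
theorem torusChar_zero (t : Torus r) : torusChar 0 t = 1 := by simp [torusChar]

@[simp]
theorem norm_torusChar (k : Fin r → ℤ) (t : Torus r) : ‖torusChar k t‖ = 1 := by
  simp [torusChar, norm_prod, norm_zpow, Circle.norm_coe]

theorem torusChar_ne_zero (k : Fin r → ℤ) (t : Torus r) : torusChar k t ≠ 0 := by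
  rw [← norm_ne_zero_iff]; simp

theorem torusChar_neg (k : Fin r → ℤ) (t : Torus r) :
    torusChar (-k) t = (torusChar k t)⁻¹ := by
  apply eq_inv_of_mul_eq_one_left
  rw [← torusChar_add]; simp

theorem torusChar_neg_mul (k : Fin r → ℤ) (t : Torus r) :
    torusChar (-k) t * torusChar k t = 1 := by
  rw [torusChar_neg, inv_mul_cancel₀ (torusChar_ne_zero k t)]

theorem conj_torusChar (k : Fin r → ℤ) (t : Torus r) :
    (starRingEnd ℂ) (torusChar k t) = torusChar (-k) t := by
  rw [torusChar_neg, Complex.inv_eq_conj (norm_torusChar k t)]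

theorem torusChar_sum {ι : Type*} (s : Finset ι) (c : ι → ℤ) (a : ι → Fin r → ℤ) (t : Torus r) :
    torusChar (fun j => ∑ l ∈ s, c l * a l j) t = ∏ l ∈ s, torusChar (a l) t ^ c l := by
  classical
  induction s using Finset.induction_on with
  | empty => simp [torusChar]
  | insert i s hi ih =>
    rw [Finset.prod_insert hi, ← ih]
    simp only [Finset.sum_insert hi]
    rw [← Pi.add_def, torusChar_add]
    congr 1
    simp [torusChar, ← Finset.prod_zpow, mul_comm (c i), zpow_mul]

theorem continuous_torusChar (k : Fin r → ℤ) : Continuous (torusChar (r := r) k) := by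
  unfold torusChar
  refine continuous_finsetProd _ fun j _ => ?_
  exact Continuous.zpow₀ (by fun_prop) _ fun t => Or.inl (Circle.coe_ne_zero _)

theorem exists_torusChar_ne_one {k : Fin r → ℤ} (hk : k ≠ 0) :
    ∃ t : Torus r, torusChar k t ≠ 1 := by
  obtain ⟨j, hj⟩ := Function.ne_iff.1 hk
  -- The angle `π / k_j` in the `j`-th slot gives the value `e^{iπ} = -1`.
  refine ⟨Pi.mulSingle j (Circle.exp (Real.pi / k j)), ?_⟩
  have h1 : torusChar k (Pi.mulSingle j (Circle.exp (Real.pi / k j))) = -1 := by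
    unfold torusChar
    rw [Finset.prod_eq_single j]
    · have hk0 : (k j : ℂ) ≠ 0 := by exact_mod_cast hj
      rw [Pi.mulSingle_eq_same, Circle.coe_exp, ← Complex.exp_int_mul]
      rw [← Complex.exp_pi_mul_I]
      congr 1
      push_cast
      field_simp
    · intro i _ hij
      simp [Pi.mulSingle_eq_of_ne hij]
    · simp
  rw [h1]
  norm_num

/-- Translation by `s` preserves the integral and multiplies it by `torusChar k s`, which is not `1`
for some `s`. -/
theorem integral_torusChar_eq_zero {k : Fin r → ℤ} (hk : k ≠ 0) :
    ∫ t, torusChar k t ∂(torusHaar r) = 0 := by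
  obtain ⟨s, hs⟩ := exists_torusChar_ne_one hk
  have h := integral_mul_left_eq_self (μ := torusHaar r) (torusChar k) s
  simp only [torusChar_mul, integral_const_mul] at h
  have h2 : (torusChar k s - 1) * ∫ t, torusChar k t ∂(torusHaar r) = 0 := by
    rw [sub_mul, h, one_mul, sub_self]
  exact (mul_eq_zero.1 h2).resolve_left (sub_ne_zero.2 hs)

/-- The characters of the torus as continuous functions. -/
noncomputable def torusCharMap (k : Fin r → ℤ) : C(Torus r, ℂ) :=
  ⟨torusChar k, continuous_torusChar k⟩

/-- The star subalgebra of trigonometric polynomials on the torus. -/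
noncomputable def trigonometricPolynomials (r : ℕ) : StarSubalgebra ℂ C(Torus r, ℂ) where
  toSubalgebra := Algebra.adjoin ℂ (Set.range torusCharMap)
  star_mem' := by
    change Algebra.adjoin ℂ (Set.range torusCharMap) ≤
      star (Algebra.adjoin ℂ (Set.range torusCharMap))
    refine Algebra.adjoin_le ?_
    rintro _ ⟨k, rfl⟩
    refine Algebra.subset_adjoin ⟨-k, ?_⟩
    ext t
    exact (conj_torusChar k t).symm

/-- Products of characters are characters. Thus a linear functional that kills the characters kills
the whole algebra. -/
theorem trigonometricPolynomials_eq_span :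
    (trigonometricPolynomials r).toSubalgebra.toSubmodule =
      Submodule.span ℂ (Set.range torusCharMap) := by
  apply Algebra.adjoin_eq_span_of_subset
  refine .trans (fun x => Submonoid.closure_induction (fun _ => id) ⟨0, ?_⟩ ?_)
    Submodule.subset_span
  · ext t
    simp [torusCharMap]
  · rintro _ _ _ _ ⟨k, rfl⟩ ⟨l, rfl⟩
    refine ⟨k + l, ?_⟩
    ext t
    simp [torusCharMap, torusChar_add]

theorem trigonometricPolynomials_separatesPoints :
    (trigonometricPolynomials r).SeparatesPoints := by
  classical
  intro x y hxy
  obtain ⟨j, hj⟩ := Function.ne_iff.1 hxy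
  refine ⟨_, ⟨torusCharMap (Pi.single j 1), Algebra.subset_adjoin ⟨_, rfl⟩, rfl⟩, ?_⟩
  have h : ∀ t : Torus r, torusChar (Pi.single j 1) t = t j := by
    intro t
    unfold torusChar
    rw [Finset.prod_eq_single j]
    · simp
    · intro i _ hij
      simp [Pi.single_eq_of_ne hij]
    · simp
  change torusChar _ x ≠ torusChar _ y
  rw [h, h]
  exact fun h' => hj (Circle.ext h')

/-- A continuous function on the torus all of whose Fourier coefficients vanish is zero. -/
theorem eq_zero_of_fourier_eq_zero {F : Torus r → ℂ} (hF : Continuous F)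
    (h : ∀ k : Fin r → ℤ, ∫ t, torusChar (-k) t * F t ∂(torusHaar r) = 0) (t : Torus r) :
    F t = 0 := by
  have hint : ∀ G : Torus r → ℂ, Continuous G → Integrable G (torusHaar r) := fun G hG =>
    hG.integrable_of_hasCompactSupport (HasCompactSupport.of_compactSpace G)
  let F' : C(Torus r, ℂ) := ⟨F, hF⟩
  -- Pairing with `F` kills all characters, hence by Stone–Weierstrass every continuous function.
  -- Pairing with the conjugate of `F` then gives `∫ ‖F‖² = 0`.
  let L : C(Torus r, ℂ) →ₗ[ℂ] ℂ :=
    { toFun := fun G => ∫ t, G t * F t ∂(torusHaar r)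
      map_add' := fun G₁ G₂ => by
        simp only [ContinuousMap.add_apply, add_mul]
        exact integral_add (hint _ (G₁.continuous.mul hF)) (hint _ (G₂.continuous.mul hF))
      map_smul' := fun c G => by
        simp only [ContinuousMap.smul_apply, smul_eq_mul, mul_assoc, integral_const_mul,
          RingHom.id_apply] }
  have hbound : ∀ G, ‖L G‖ ≤ ‖F'‖ * ‖G‖ := by
    intro G
    have := norm_integral_le_of_norm_le_const (μ := torusHaar r) (f := fun t => G t * F t)
      (C := ‖F'‖ * ‖G‖) (Filter.Eventually.of_forall fun t => by
        rw [norm_mul, mul_comm]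
        exact mul_le_mul (F'.norm_coe_le_norm t) (G.norm_coe_le_norm t) (norm_nonneg _)
          (norm_nonneg _))
    simpa [L] using this
  let L' : C(Torus r, ℂ) →L[ℂ] ℂ := L.mkContinuous ‖F'‖ hbound
  have hspan : Submodule.span ℂ (Set.range torusCharMap) ≤ LinearMap.ker L'.toLinearMap := by
    rw [Submodule.span_le]
    rintro _ ⟨k, rfl⟩
    have := h (-k)
    rw [neg_neg] at this
    exact this
  have hstar : L' (star F') = 0 := by
    have h1 : star F' ∈ (trigonometricPolynomials r).topologicalClosure := by
      rw [ContinuousMap.starSubalgebra_topologicalClosure_eq_top_of_separatesPoints _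
        trigonometricPolynomials_separatesPoints]
      trivial
    have h2 : ((trigonometricPolynomials r : Set C(Torus r, ℂ))) ⊆ {G | L' G = 0} := by
      intro G hG
      have : G ∈ (trigonometricPolynomials r).toSubalgebra.toSubmodule := hG
      rw [trigonometricPolynomials_eq_span] at this
      exact hspan this
    exact closure_minimal h2 (isClosed_singleton.preimage L'.continuous) h1
  have h3 : ∫ t, ‖F t‖ ^ 2 ∂(torusHaar r) = 0 := by
    have h4 : ((∫ t, ‖F t‖ ^ 2 ∂(torusHaar r) : ℝ) : ℂ) = L' (star F') := by
      rw [← integral_complex_ofReal]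
      refine integral_congr_ae (Filter.Eventually.of_forall fun t => ?_)
      simp only [Complex.ofReal_pow]
      exact (Complex.conj_mul' (F t)).symm
    rw [hstar] at h4
    exact_mod_cast h4
  have hc : Continuous fun t => ‖F t‖ ^ 2 := by fun_prop
  have h5 := (Continuous.integral_pos_of_hasCompactSupport_nonneg_nonzero (μ := torusHaar r)
    (x := t) hc (HasCompactSupport.of_compactSpace _) fun t => by positivity)
  by_contra hne
  have := h5 (by simpa using hne)
  linarith

end TorusCharacters

/-! ### Diagonalizing the action. -/

section Action

variable {r n : ℕ} {ρ : Torus r →* Matrix.GeneralLinearGroup (Fin n) ℂ}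

theorem act_mul (s t : Torus r) (z : Fin n → ℂ) : act ρ (s * t) z = act ρ s (act ρ t z) := by
  simp [act, Matrix.mulVec_mulVec]

@[simp]
theorem act_one (z : Fin n → ℂ) : act ρ 1 z = z := by simp [act]

/-- The action of a torus element as a continuous linear map. -/
noncomputable def actCLM (ρ : Torus r →* Matrix.GeneralLinearGroup (Fin n) ℂ) (t : Torus r) :
    (Fin n → ℂ) →L[ℂ] (Fin n → ℂ) :=
  LinearMap.toContinuousLinearMap (Matrix.mulVecLin (ρ t : Matrix (Fin n) (Fin n) ℂ))

theorem actCLM_apply (t : Torus r) (z : Fin n → ℂ) : actCLM ρ t z = act ρ t z := rfl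

theorem continuous_act (hρ : Continuous ρ) :
    Continuous fun q : Torus r × (Fin n → ℂ) => act ρ q.1 q.2 := by
  unfold act
  exact (Units.continuous_val.comp (hρ.comp continuous_fst)).matrix_mulVec continuous_snd

/-- Weight vectors span, since the Fourier components of the orbit map of a vector are weight
vectors. -/
theorem exists_isWeightBasis (hρ : Continuous ρ) :
    ∃ (b : Module.Basis (Fin n) ℂ (Fin n → ℂ)) (a : Fin n → Fin r → ℤ),
      IsWeightBasis ρ b a := by
  have hct : ∀ z, Continuous fun t => act ρ t z := fun z =>
    (continuous_act hρ).comp (by fun_prop : Continuous fun t : Torus r => (t, z))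
  have hint : ∀ (k : Fin r → ℤ) z,
      Integrable (fun t => torusChar (-k) t • act ρ t z) (torusHaar r) := fun k z =>
    ((continuous_torusChar _).smul (hct z)).integrable_of_hasCompactSupport
      (HasCompactSupport.of_compactSpace _)
  let S : Set (Fin n → ℂ) := {v | ∃ k : Fin r → ℤ, ∀ t, act ρ t v = torusChar k t • v}
  have hmem : ∀ (k : Fin r → ℤ) z, ∫ t, torusChar (-k) t • act ρ t z ∂(torusHaar r) ∈ S := by
    intro k z
    refine ⟨k, fun s => ?_⟩
    rw [← actCLM_apply, ← ContinuousLinearMap.integral_comp_comm _ (hint k z),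
      ← integral_smul, ← integral_mul_left_eq_self (μ := torusHaar r)
        (fun t => torusChar k s • torusChar (-k) t • act ρ t z) s]
    refine integral_congr_ae (Filter.Eventually.of_forall fun t => ?_)
    simp only [map_smul, actCLM_apply, torusChar_mul, act_mul, smul_smul]
    rw [← mul_assoc, mul_comm (torusChar k s), torusChar_neg_mul, one_mul]
  have hS : ⊤ ≤ Submodule.span ℂ S := by
    rw [top_le_iff]
    by_contra hne
    obtain ⟨v, hv⟩ : ∃ v, v ∉ Submodule.span ℂ S := by
      by_contra! hall
      exact hne (Submodule.eq_top_iff'.2 hall)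
    -- If weight vectors did not span, this `ℓ` would kill them all. Then `t ↦ ℓ (ρ(t) v)` has zero
    -- Fourier coefficients, so `ℓ v = 0` at `t = 1`.
    obtain ⟨ℓ, hℓv, hℓ⟩ := Submodule.exists_le_ker_of_notMem hv
    have h0 := eq_zero_of_fourier_eq_zero (r := r) (F := fun t => ℓ (act ρ t v))
      ((LinearMap.continuous_of_finiteDimensional ℓ).comp (hct v)) (fun k => ?_) 1
    · exact hℓv (by simpa using h0)
    · have h1 := hℓ (Submodule.subset_span (hmem k v))
      rw [LinearMap.mem_ker] at h1
      have h2 := (LinearMap.toContinuousLinearMap ℓ).integral_comp_comm (hint k v)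
      simp only [LinearMap.coe_toContinuousLinearMap', h1, map_smul, smul_eq_mul] at h2
      exact h2
  let B := Module.Basis.ofSpan hS
  have : Fintype ((linearIndepOn_empty ℂ (id : (Fin n → ℂ) → _)).extend (Set.empty_subset S)) :=
    FiniteDimensional.fintypeBasisIndex B
  have hcard : Fintype.card
      ((linearIndepOn_empty ℂ (id : (Fin n → ℂ) → _)).extend (Set.empty_subset S)) =
        Fintype.card (Fin n) := by
    rw [← Module.finrank_eq_card_basis B]; simp
  let b := B.reindex (Fintype.equivOfCardEq hcard)
  have hb : ∀ i, b i ∈ S := fun i => by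
    apply Module.Basis.ofSpan_subset hS
    simp [b, B]
  choose a ha using hb
  exact ⟨b, a, fun t i => ha i t⟩

end Action

/-! ### Monomials, their weights and orders of vanishing. -/

section WeightPolynomials

open Set Filter Topology Asymptotics

variable {r n : ℕ}

/-- The linear coordinate `z_i` with respect to the basis `b`, as a polynomial. -/
noncomputable def linForm (b : Module.Basis (Fin n) ℂ (Fin n → ℂ)) (i : Fin n) :
    MvPolynomial (Fin n) ℂ :=
  ∑ j, MvPolynomial.C (b.equivFun (Pi.single j 1) i) * MvPolynomial.X j

/-- The monomial `z^α` in the coordinates with respect to the basis `b`. -/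
noncomputable def basisMonomial (b : Module.Basis (Fin n) ℂ (Fin n → ℂ)) (α : Fin n → ℕ) :
    MvPolynomial (Fin n) ℂ :=
  ∏ i, linForm b i ^ α i

/-- The weight `α_1 a_1 + ⋯ + α_n a_n` of the monomial `z^α`. -/
def monomialWeight (a : Fin n → Fin r → ℤ) (α : Fin n → ℕ) : Fin r → ℤ :=
  fun j => ∑ l, (α l : ℤ) * a l j

/-- The span of the monomials of weight `k`. -/
noncomputable def weightPolys (b : Module.Basis (Fin n) ℂ (Fin n → ℂ)) (a : Fin n → Fin r → ℤ)
    (k : Fin r → ℤ) : Submodule ℂ (MvPolynomial (Fin n) ℂ) :=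
  Submodule.span ℂ (basisMonomial b '' {α | monomialWeight a α = k})

variable {b : Module.Basis (Fin n) ℂ (Fin n → ℂ)} {a : Fin n → Fin r → ℤ}
  {ρ : Torus r →* Matrix.GeneralLinearGroup (Fin n) ℂ} {D : Set (Fin n → ℂ)}

@[simp]
theorem eval_linForm (i : Fin n) (z : Fin n → ℂ) :
    MvPolynomial.eval z (linForm b i) = b.equivFun z i := by
  have h : z = ∑ j, z j • (Pi.single j 1 : Fin n → ℂ) := by
    ext l; simp [Finset.sum_apply, Pi.single_apply]
  conv_rhs => rw [h]
  simp [linForm, mul_comm]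

theorem isHomogeneous_linForm (i : Fin n) : (linForm b i).IsHomogeneous 1 := by
  refine MvPolynomial.IsHomogeneous.sum _ _ _ fun j _ => ?_
  simpa using (MvPolynomial.isHomogeneous_C (Fin n) _).mul (MvPolynomial.isHomogeneous_X ℂ j)

theorem eval_basisMonomial (α : Fin n → ℕ) (z : Fin n → ℂ) :
    MvPolynomial.eval z (basisMonomial b α) = ∏ i, b.equivFun z i ^ α i := by
  simp [basisMonomial, -Module.Basis.equivFun_apply]

/-- At the point with all coordinates `1` every monomial is visibly nonzero. -/
theorem eval_basisMonomial_sum (α : Fin n → ℕ) :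
    MvPolynomial.eval (∑ i, b i) (basisMonomial b α) = 1 := by
  rw [eval_basisMonomial]
  refine Finset.prod_eq_one fun i _ => ?_
  simp [map_sum, Finset.sum_apply, Finsupp.single_apply]

theorem basisMonomial_ne_zero (α : Fin n → ℕ) : basisMonomial b α ≠ 0 := by
  intro h
  have := eval_basisMonomial_sum (b := b) α
  simp [h] at this

theorem isHomogeneous_basisMonomial (α : Fin n → ℕ) :
    (basisMonomial b α).IsHomogeneous (∑ i, α i) := by
  refine MvPolynomial.IsHomogeneous.prod _ _ _ fun i _ => ?_
  simpa using (isHomogeneous_linForm i).pow (α i)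

theorem totalDegree_basisMonomial (α : Fin n → ℕ) :
    (basisMonomial b α).totalDegree = ∑ i, α i :=
  (isHomogeneous_basisMonomial α).totalDegree (basisMonomial_ne_zero α)

theorem monomialWeight_single [DecidableEq (Fin n)] (i : Fin n) :
    monomialWeight a (Pi.single i 1) = a i := by
  funext j
  simp [monomialWeight, Pi.single_apply]

theorem basisMonomial_mem (α : Fin n → ℕ) :
    basisMonomial b α ∈ weightPolys b a (monomialWeight a α) :=
  Submodule.subset_span ⟨α, rfl, rfl⟩

theorem IsWeightBasis.equivFun_act (hb : IsWeightBasis ρ b a) (t : Torus r) (z : Fin n → ℂ)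
    (i : Fin n) : b.equivFun (act ρ t z) i = torusChar (a i) t * b.equivFun z i := by
  conv_lhs => rw [← b.sum_equivFun z]
  rw [← actCLM_apply, map_sum]
  simp only [map_smul, actCLM_apply, hb t]
  simp [Finsupp.single_apply, mul_comm]

theorem IsWeightBasis.eval_basisMonomial_act (hb : IsWeightBasis ρ b a) (t : Torus r)
    (z : Fin n → ℂ) (α : Fin n → ℕ) :
    MvPolynomial.eval (act ρ t z) (basisMonomial b α) =
      torusChar (monomialWeight a α) t * MvPolynomial.eval z (basisMonomial b α) := by
  unfold monomialWeight
  rw [torusChar_sum, eval_basisMonomial, eval_basisMonomial, ← Finset.prod_mul_distrib]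
  exact Finset.prod_congr rfl fun i _ => by rw [hb.equivFun_act, mul_pow, zpow_natCast]

theorem IsWeightBasis.eval_act (hb : IsWeightBasis ρ b a) {k : Fin r → ℤ}
    {p : MvPolynomial (Fin n) ℂ} (hp : p ∈ weightPolys b a k) (t : Torus r) (z : Fin n → ℂ) :
    MvPolynomial.eval (act ρ t z) p = torusChar k t * MvPolynomial.eval z p := by
  induction hp using Submodule.span_induction with
  | mem x h =>
    obtain ⟨α, hα, rfl⟩ := h
    rw [hb.eval_basisMonomial_act, show monomialWeight a α = k from hα]
  | zero => simp
  | add x y _ _ hx hy => simp [hx, hy, mul_add]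
  | smul c x _ hx => simp [hx, MvPolynomial.smul_eval]; ring

theorem totalDegree_le_of_mem_weightPolys {k : Fin r → ℤ} {N : ℕ}
    (hN : ∀ α, monomialWeight a α = k → ∑ i, α i ≤ N)
    {p : MvPolynomial (Fin n) ℂ} (hp : p ∈ weightPolys b a k) : p.totalDegree ≤ N := by
  induction hp using Submodule.span_induction with
  | mem x h =>
    obtain ⟨α, hα, rfl⟩ := h
    rw [totalDegree_basisMonomial]
    exact hN α hα
  | zero => simp
  | add x y _ _ hx hy => exact (MvPolynomial.totalDegree_add _ _).trans (max_le hx hy)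
  | smul c x _ hx => exact (MvPolynomial.totalDegree_smul_le _ _).trans hx

theorem differentiable_eval (p : MvPolynomial (Fin n) ℂ) :
    Differentiable ℂ fun z => MvPolynomial.eval z p := by
  induction p using MvPolynomial.induction_on with
  | C c => simp
  | add p q hp hq =>
    simp only [map_add]
    exact hp.fun_add hq
  | mul_X p i hp =>
    simp only [map_mul, MvPolynomial.eval_X]
    exact hp.fun_mul (differentiable_apply i)

/-- Lowest degree is recorded as an order of vanishing because that survives composition with a
holomorphic map fixing `0` and averaging over the torus. -/
theorem isBigO_eval_of_mem_weightPolys {k : Fin r → ℤ} {m : ℕ}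
    (hm : ∀ α, monomialWeight a α = k → m ≤ ∑ i, α i)
    {p : MvPolynomial (Fin n) ℂ} (hp : p ∈ weightPolys b a k) :
    (fun z => MvPolynomial.eval z p) =O[𝓝 0] fun z => ‖z‖ ^ m := by
  induction hp using Submodule.span_induction with
  | mem x h =>
    obtain ⟨α, hα, rfl⟩ := h
    have h1 : ∀ i, (fun z => b.equivFun z i) =O[𝓝 (0 : Fin n → ℂ)] fun z => ‖z‖ := by
      intro i
      exact ((LinearMap.toContinuousLinearMap
        (b.coord i)).isBigO_id (𝓝 0)).norm_right
    have h2 := IsBigO.finsetProd (s := Finset.univ) fun i _ => (h1 i).pow (α i)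
    simp only [eval_basisMonomial]
    refine h2.trans ?_
    simp only [Finset.prod_pow_eq_pow_sum]
    refine IsBigO.of_bound 1 ?_
    filter_upwards [Metric.ball_mem_nhds (0 : Fin n → ℂ) one_pos] with z hz
    rw [mem_ball_zero_iff] at hz
    simpa using pow_le_pow_of_le_one (norm_nonneg z) hz.le (hm α hα)
  | zero => simpa using isBigO_zero _ _
  | add x y _ _ hx hy => simpa using hx.add hy
  | smul c x _ hx => simpa [MvPolynomial.smul_eval] using hx.const_mul_left c

/-- Factors are peeled off one at a time: if `s^m u(s) = O(s^{m+1})`, then `u(s) = O(s)` off `0`, so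
`u(0) = 0`. -/
theorem X_pow_dvd_of_isBigO {q : Polynomial ℂ} {m : ℕ}
    (h : (fun s : ℂ => q.eval s) =O[𝓝 0] fun s => s ^ m) : Polynomial.X ^ m ∣ q := by
  induction m with
  | zero => simp
  | succ m ih =>
    have h1 : (fun s : ℂ => s ^ (m + 1)) =O[𝓝 0] fun s => s ^ m := by
      refine IsBigO.of_bound 1 ?_
      filter_upwards [Metric.ball_mem_nhds (0 : ℂ) one_pos] with z hz
      rw [mem_ball_zero_iff] at hz
      simpa using pow_le_pow_of_le_one (norm_nonneg z) hz.le (Nat.le_succ m)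
    obtain ⟨u, rfl⟩ := ih (h.trans h1)
    rw [pow_succ]
    refine mul_dvd_mul_left _ ?_
    rw [Polynomial.X_dvd_iff, Polynomial.coeff_zero_eq_eval_zero]
    obtain ⟨C, hC⟩ := h.bound
    have h2 : ∀ᶠ s : ℂ in 𝓝[≠] 0, ‖u.eval s‖ ≤ C * ‖s‖ := by
      filter_upwards [nhdsWithin_le_nhds hC, self_mem_nhdsWithin] with s hs hs0
      have hs0' : (0 : ℝ) < ‖s‖ ^ m := pow_pos (norm_pos_iff.2 hs0) m
      simp only [Polynomial.eval_mul, Polynomial.eval_pow, Polynomial.eval_X, norm_mul,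
        norm_pow] at hs
      refine le_of_mul_le_mul_left ?_ hs0'
      calc _ ≤ C * ‖s‖ ^ (m + 1) := hs
        _ = _ := by ring
    have h3 : Tendsto (fun s => ‖u.eval s‖) (𝓝[≠] 0) (𝓝 ‖u.eval 0‖) :=
      (u.continuous.norm.tendsto 0).mono_left nhdsWithin_le_nhds
    have h4 : Tendsto (fun s : ℂ => C * ‖s‖) (𝓝[≠] 0) (𝓝 0) := by
      have : Tendsto (fun s : ℂ => C * ‖s‖) (𝓝 0) (𝓝 (C * ‖(0 : ℂ)‖)) :=
        (by fun_prop : Continuous fun s : ℂ => C * ‖s‖).tendsto 0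
      rw [norm_zero, mul_zero] at this
      exact this.mono_left nhdsWithin_le_nhds
    exact norm_le_zero_iff.1 (le_of_tendsto_of_tendsto h3 h4 h2)

theorem eval_smul_of_isHomogeneous {p : MvPolynomial (Fin n) ℂ} {j : ℕ} (hp : p.IsHomogeneous j)
    (s : ℂ) (z : Fin n → ℂ) :
    MvPolynomial.eval (s • z) p = s ^ j * MvPolynomial.eval z p := by
  rw [MvPolynomial.eval_eq', MvPolynomial.eval_eq', Finset.mul_sum]
  refine Finset.sum_congr rfl fun d hd => ?_
  have h1 : ∑ i, d i = j := by
    rw [← Finsupp.degree_eq_sum, Finsupp.degree_eq_weight_one]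
    exact hp (MvPolynomial.mem_support_iff.1 hd)
  simp only [Pi.smul_apply, smul_eq_mul, mul_pow, Finset.prod_mul_distrib,
    Finset.prod_pow_eq_pow_sum, h1]
  ring

/-- A polynomial of degree at most `m` that vanishes to order `m + 1` at the origin is zero. -/
theorem eq_zero_of_totalDegree_le_of_isBigO {p : MvPolynomial (Fin n) ℂ} {m : ℕ}
    (hp : p.totalDegree ≤ m)
    (h : (fun z => MvPolynomial.eval z p) =O[𝓝 0] fun z => ‖z‖ ^ (m + 1)) : p = 0 := by
  apply MvPolynomial.funext
  intro z
  -- The restriction of `p` to the line `s ↦ s • z`. Its degree is at most `m` and `X ^ (m + 1)`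
  -- divides it, so it is zero; take `s = 1`.
  let q : Polynomial ℂ := ∑ j ∈ Finset.range (m + 1),
    Polynomial.C (MvPolynomial.eval z (MvPolynomial.homogeneousComponent j p)) * Polynomial.X ^ j
  have hsum : ∑ j ∈ Finset.range (m + 1), MvPolynomial.homogeneousComponent j p = p := by
    conv_rhs => rw [← MvPolynomial.sum_homogeneousComponent p]
    symm
    refine Finset.sum_subset (Finset.range_mono (by omega)) fun j _ hj => ?_
    apply MvPolynomial.homogeneousComponent_eq_zero
    simpa using hj
  have hq : ∀ s : ℂ, q.eval s = MvPolynomial.eval (s • z) p := by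
    intro s
    conv_rhs => rw [← hsum]
    rw [map_sum]
    simp only [q, Polynomial.eval_finsetSum]
    refine Finset.sum_congr rfl fun j _ => ?_
    rw [eval_smul_of_isHomogeneous (MvPolynomial.homogeneousComponent_isHomogeneous j p),
      Polynomial.eval_mul, Polynomial.eval_C, Polynomial.eval_pow, Polynomial.eval_X, mul_comm]
  have hO : (fun s : ℂ => q.eval s) =O[𝓝 0] fun s => s ^ (m + 1) := by
    have h1 : Tendsto (fun s : ℂ => s • z) (𝓝 0) (𝓝 0) := by
      have := (by fun_prop : Continuous fun s : ℂ => s • z).tendsto 0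
      rwa [zero_smul] at this
    have h2 := h.comp_tendsto h1
    simp only [hq]
    refine h2.trans ?_
    refine IsBigO.of_bound (‖z‖ ^ (m + 1)) (Eventually.of_forall fun s => ?_)
    simp [norm_smul, mul_pow, mul_comm]
  have hdeg : q.natDegree < (Polynomial.X ^ (m + 1) : Polynomial ℂ).natDegree := by
    rw [Polynomial.natDegree_X_pow, Nat.lt_succ_iff]
    refine Polynomial.natDegree_sum_le_of_forall_le _ _ fun j hj => ?_
    exact (Polynomial.natDegree_C_mul_X_pow_le _ _).trans
      (Nat.lt_succ_iff.1 (Finset.mem_range.1 hj))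
  have h0 := Polynomial.eq_zero_of_dvd_of_natDegree_lt (X_pow_dvd_of_isBigO hO) hdeg
  have h1 := hq 1
  rw [h0, one_smul] at h1
  simpa using h1.symm

/-- If only constants are invariant, then no nonconstant monomial is invariant. -/
theorem eq_zero_of_monomialWeight_eq_zero (hinv : OnlyConstantInvariants ρ)
    (hb : IsWeightBasis ρ b a) (α : Fin n → ℕ) (hα : monomialWeight a α = 0) : α = 0 := by
  obtain ⟨c, hc⟩ := hinv _ (differentiable_eval (basisMonomial b α)) fun t z => by
    rw [hb.eval_basisMonomial_act, hα, torusChar_zero, one_mul]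
  -- The monomial is `1` here and, unless `α = 0`, vanishes at the origin.
  have h1 := hc (∑ i, b i)
  rw [eval_basisMonomial_sum] at h1
  have h2 := hc 0
  rw [eval_basisMonomial, ← h1] at h2
  by_contra hne
  obtain ⟨i, hi⟩ := Function.ne_iff.1 hne
  rw [Finset.prod_eq_zero (Finset.mem_univ i)] at h2
  · exact zero_ne_one h2
  · have : α i ≠ 0 := hi
    simp [this]

/-- By Dickson's lemma there are finitely many monomials of each weight. -/
theorem finite_setOf_monomialWeight_eq
    (hpos : ∀ α : Fin n → ℕ, monomialWeight a α = 0 → α = 0) (k : Fin r → ℤ) :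
    {α : Fin n → ℕ | monomialWeight a α = k}.Finite := by
  -- If `α ≤ β` have the same weight, then `β - α` has weight `0`, hence is `0`.
  have hanti : IsAntichain (· ≤ ·) {α : Fin n → ℕ | monomialWeight a α = k} := by
    intro α hα β hβ hne hle
    apply hne
    have h1 : monomialWeight a (β - α) = 0 := by
      funext j
      have h2 := congrFun (hβ.trans hα.symm) j
      simp only [monomialWeight] at h2 ⊢
      have h3 : ∀ l, (((β - α) l : ℕ) : ℤ) * a l j = β l * a l j - α l * a l j := by
        intro l
        rw [Pi.sub_apply, Nat.cast_sub (hle l), sub_mul]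
      simp only [h3, Finset.sum_sub_distrib, h2, sub_self, Pi.zero_apply]
    have h4 := hpos _ h1
    funext l
    have h5 := congrFun h4 l
    simp only [Pi.sub_apply, Pi.zero_apply] at h5
    exact le_antisymm (hle l) (Nat.sub_eq_zero_iff_le.1 h5)
  exact hanti.finite_of_partiallyWellOrderedOn (Set.isPWO_of_wellQuasiOrderedLE _)

theorem exists_degree_bound (hpos : ∀ α : Fin n → ℕ, monomialWeight a α = 0 → α = 0)
    (k : Fin r → ℤ) : ∃ N, ∀ α, monomialWeight a α = k → ∑ i, α i ≤ N := by
  obtain ⟨N, hN⟩ := ((finite_setOf_monomialWeight_eq hpos k).image fun α => ∑ i, α i).bddAbove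
  exact ⟨N, fun α hα => hN ⟨α, hα, rfl⟩⟩

/-- Polynomials that agree on an open neighbourhood of the origin are equal. -/
theorem eq_of_eval_eq_on (hD : IsOpen D) (h0 : (0 : Fin n → ℂ) ∈ D)
    {p q : MvPolynomial (Fin n) ℂ}
    (h : ∀ z ∈ D, MvPolynomial.eval z p = MvPolynomial.eval z q) : p = q := by
  rw [← sub_eq_zero]
  apply MvPolynomial.funext
  intro z
  rw [map_zero]
  refine eqOn_zero_of_eventuallyEq_zero isOpen_univ isPreconnected_univ
    (differentiable_eval (p - q)).differentiableOn (mem_univ 0) ?_ (mem_univ z)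
  filter_upwards [hD.mem_nhds h0] with w hw
  simp [h w hw]

end WeightPolynomials

/-! ### Weight components of holomorphic functions. -/

section WeightComponents

open Set Filter Topology Asymptotics

variable {r n : ℕ} {b : Module.Basis (Fin n) ℂ (Fin n → ℂ)} {a : Fin n → Fin r → ℤ}
  {ρ : Torus r →* Matrix.GeneralLinearGroup (Fin n) ℂ} {D : Set (Fin n → ℂ)}

/-- A homogeneous form of weight `k` is a combination of monomials of weight `k` of its degree. -/
theorem exists_weightPoly_of_multilinear (hb : IsWeightBasis ρ b a) {k : Fin r → ℤ} {m : ℕ}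
    (q : ContinuousMultilinearMap ℂ (fun _ : Fin m => Fin n → ℂ) ℂ)
    (hq : ∀ (t : Torus r) z, (q fun _ => act ρ t z) = torusChar k t * q fun _ => z) :
    ∃ p ∈ weightPolys b a k, (∀ z, (q fun _ => z) = MvPolynomial.eval z p) ∧
      ((∀ α, monomialWeight a α = k → ∑ i, α i ≠ m) → p = 0) := by
  classical
  -- `e σ` is the exponent of the monomial `∏ j, z_{σ j}`.
  let e : (Fin m → Fin n) → Fin n → ℕ := fun σ l => (Finset.univ.filter fun j => σ j = l).card
  have he : ∀ σ z, ∏ j, b.equivFun z (σ j) = MvPolynomial.eval z (basisMonomial b (e σ)) := by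
    intro σ z
    rw [eval_basisMonomial, ← Finset.prod_fiberwise' Finset.univ σ fun i => b.equivFun z i]
    exact Finset.prod_congr rfl fun l _ => by rw [Finset.prod_const]
  have hdeg : ∀ σ, ∑ l, e σ l = m := by
    intro σ
    have := Finset.card_eq_sum_card_fiberwise (s := Finset.univ) (t := Finset.univ) (f := σ)
      (by simp)
    simpa using this.symm
  have hexp : ∀ z, (q fun _ => z) =
      ∑ σ : Fin m → Fin n, MvPolynomial.eval z (basisMonomial b (e σ)) * q fun j => b (σ j) := by
    intro z
    have h1 : (fun _ : Fin m => z) = fun _ => ∑ i, b.equivFun z i • b i := by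
      funext _; exact (b.sum_equivFun z).symm
    conv_lhs => rw [h1]
    rw [ContinuousMultilinearMap.map_sum]
    refine Finset.sum_congr rfl fun σ _ => ?_
    rw [ContinuousMultilinearMap.map_smul_univ, he, smul_eq_mul]
  let S := Finset.univ.filter fun σ : Fin m → Fin n => monomialWeight a (e σ) = k
  refine ⟨∑ σ ∈ S, (q fun j => b (σ j)) • basisMonomial b (e σ), ?_, fun z => ?_, fun h => ?_⟩
  · refine Submodule.sum_mem _ fun σ hσ => Submodule.smul_mem _ _ ?_
    exact Submodule.subset_span ⟨e σ, (Finset.mem_filter.1 hσ).2, rfl⟩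
  -- The left side does not depend on `t`; averaging the right side over the torus removes every
  -- monomial of weight other than `k`.
  · have h1 : ∀ t : Torus r, (q fun _ => z) =
        ∑ σ : Fin m → Fin n, torusChar (monomialWeight a (e σ) - k) t *
          (MvPolynomial.eval z (basisMonomial b (e σ)) * q fun j => b (σ j)) := by
      intro t
      have h2 := hq t z
      rw [hexp (act ρ t z)] at h2
      calc (q fun _ => z) = torusChar (-k) t * (torusChar k t * q fun _ => z) := by
            rw [← mul_assoc, torusChar_neg_mul, one_mul]
        _ = _ := by
            rw [← h2, Finset.mul_sum]
            refine Finset.sum_congr rfl fun σ _ => ?_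
            rw [hb.eval_basisMonomial_act, sub_eq_add_neg, torusChar_add]
            ring
    have hint : ∀ l : Fin r → ℤ, Integrable (torusChar l) (torusHaar r) := fun l =>
      (continuous_torusChar l).integrable_of_hasCompactSupport
        (HasCompactSupport.of_compactSpace _)
    have h3 : (q fun _ => z) = ∫ _t : Torus r, (q fun _ => z) ∂(torusHaar r) := by simp
    rw [h3, integral_congr_ae (Eventually.of_forall h1),
      integral_finsetSum _ fun σ _ => (hint _).mul_const _, map_sum]
    simp only [integral_mul_const]
    rw [← Finset.sum_filter_add_sum_filter_not Finset.univ
      (fun σ : Fin m → Fin n => monomialWeight a (e σ) = k)]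
    rw [Finset.sum_eq_zero (s := Finset.univ.filter fun σ => ¬ monomialWeight a (e σ) = k),
      add_zero]
    · refine Finset.sum_congr rfl fun σ hσ => ?_
      rw [(Finset.mem_filter.1 hσ).2, sub_self]
      simp [MvPolynomial.smul_eval, mul_comm]
    · intro σ hσ
      rw [integral_torusChar_eq_zero (sub_ne_zero.2 (Finset.mem_filter.1 hσ).2), zero_mul]
  · rw [Finset.sum_eq_zero]
    intro σ hσ
    exact absurd (hdeg σ) (h _ (Finset.mem_filter.1 hσ).2)

/-- A holomorphic function of weight `k` is a polynomial, namely a combination of monomials of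
weight `k`. -/
theorem exists_weightPoly (hb : IsWeightBasis ρ b a)
    (hpos : ∀ α : Fin n → ℕ, monomialWeight a α = 0 → α = 0)
    (hD : IsQuasiReinhardt ρ D) (h0 : (0 : Fin n → ℂ) ∈ D) {φ : (Fin n → ℂ) → ℂ}
    (hφ : DifferentiableOn ℂ φ D) {k : Fin r → ℤ}
    (hk : ∀ t : Torus r, ∀ z ∈ D, φ (act ρ t z) = torusChar k t * φ z) :
    ∃ p ∈ weightPolys b a k, ∀ z ∈ D, φ z = MvPolynomial.eval z p := by
  obtain ⟨R, hR, hRD⟩ := Metric.isOpen_iff.1 hD.isOpen 0 h0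
  obtain ⟨q, hsum, hcoef⟩ := exists_hasSum_homogeneous (hφ.mono hRD)
  have hq : ∀ m (t : Torus r) z, (q m fun _ => act ρ t z) = torusChar k t * q m fun _ => z := by
    intro m t z
    rw [hcoef m _ hR, hcoef m _ hR]
    -- Equivariance is known only in `D`, but Taylor coefficients need it only for small `s`.
    have h1 : (fun s : ℂ => φ (s • act ρ t z)) =ᶠ[𝓝 0] fun s => torusChar k t * φ (s • z) := by
      have h2 : Tendsto (fun s : ℂ => s • z) (𝓝 0) (𝓝 0) := by
        have := (by fun_prop : Continuous fun s : ℂ => s • z).tendsto 0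
        rwa [zero_smul] at this
      filter_upwards [h2.eventually (hD.isOpen.mem_nhds h0)] with s hs
      rw [← hk t _ hs, ← actCLM_apply, ← actCLM_apply, map_smul]
    rw [h1.iteratedDeriv_eq, iteratedDeriv_const_mul_field]
    ring
  choose p hp hpq hp0 using fun m => exists_weightPoly_of_multilinear hb (q m) (hq m)
  -- Forms of degree above `N` vanish, so the Taylor series is a finite sum near `0`; the identity
  -- theorem extends the equality to `D`.
  obtain ⟨N, hN⟩ := exists_degree_bound hpos k
  refine ⟨∑ m ∈ Finset.range (N + 1), p m, Submodule.sum_mem _ fun m _ => hp m, ?_⟩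
  have hball : ∀ z ∈ Metric.ball (0 : Fin n → ℂ) R,
      φ z = MvPolynomial.eval z (∑ m ∈ Finset.range (N + 1), p m) := by
    intro z hz
    refine (hsum z hz).unique ?_
    rw [map_sum]
    simp only [hpq]
    refine hasSum_sum_of_ne_finset_zero fun m hm => ?_
    rw [hp0 m, map_zero]
    intro α hα h
    have := hN α hα
    rw [Finset.mem_range] at hm
    omega
  intro z hz
  rw [← sub_eq_zero]
  refine eqOn_zero_of_eventuallyEq_zero (φ := fun z => φ z - MvPolynomial.eval z
    (∑ m ∈ Finset.range (N + 1), p m)) hD.isOpen hD.isConnected.isPreconnected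
    (hφ.sub (differentiable_eval _).differentiableOn) h0 ?_ hz
  filter_upwards [Metric.ball_mem_nhds (0 : Fin n → ℂ) hR] with w hw
  rw [hball w hw, sub_self, Pi.zero_apply]

/-- The component of weight `k` of a function. -/
noncomputable def weightPart (ρ : Torus r →* Matrix.GeneralLinearGroup (Fin n) ℂ)
    (k : Fin r → ℤ) (φ : (Fin n → ℂ) → ℂ) (z : Fin n → ℂ) : ℂ :=
  ∫ t, torusChar (-k) t * φ (act ρ t z) ∂(torusHaar r)

theorem weightPart_act (k : Fin r → ℤ) (φ : (Fin n → ℂ) → ℂ) (s : Torus r) (z : Fin n → ℂ) :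
    weightPart ρ k φ (act ρ s z) = torusChar k s * weightPart ρ k φ z := by
  unfold weightPart
  rw [← integral_const_mul, ← integral_mul_left_eq_self (μ := torusHaar r)
    (fun t => torusChar k s * (torusChar (-k) t * φ (act ρ t z))) s]
  refine integral_congr_ae (Eventually.of_forall fun t => ?_)
  simp only [torusChar_mul]
  rw [← act_mul, mul_comm t s, ← mul_assoc (torusChar k s), ← mul_assoc (torusChar k s),
    mul_comm (torusChar k s) (torusChar (-k) s), torusChar_neg_mul, one_mul]

theorem weightPart_zero (k : Fin r → ℤ) (φ : (Fin n → ℂ) → ℂ) (hk : k = 0) :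
    weightPart ρ k φ 0 = φ 0 := by
  subst hk
  have h : ∀ t : Torus r, act ρ t 0 = 0 := fun t => (actCLM ρ t).map_zero
  simp [weightPart, h]

theorem continuous_orbit (hρ : Continuous ρ) (z : Fin n → ℂ) :
    Continuous fun t => act ρ t z :=
  (continuous_act hρ).comp (by fun_prop : Continuous fun t : Torus r => (t, z))

theorem continuous_comp_orbit (hρ : Continuous ρ) (hD : IsQuasiReinhardt ρ D)
    {φ : (Fin n → ℂ) → ℂ} (hφ : ContinuousOn φ D) {z : Fin n → ℂ} (hz : z ∈ D) :
    Continuous fun t => φ (act ρ t z) :=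
  hφ.comp_continuous (continuous_orbit hρ z) fun t => hD.invariant t z hz

theorem integrable_weightPart (hρ : Continuous ρ) (hD : IsQuasiReinhardt ρ D)
    {φ : (Fin n → ℂ) → ℂ} (hφ : ContinuousOn φ D) {z : Fin n → ℂ} (hz : z ∈ D)
    (k : Fin r → ℤ) :
    Integrable (fun t => torusChar (-k) t * φ (act ρ t z)) (torusHaar r) :=
  ((continuous_torusChar _).mul (continuous_comp_orbit hρ hD hφ hz)).integrable_of_hasCompactSupport
    (HasCompactSupport.of_compactSpace _)

/-- The orbit of a small closed ball may leave the ball, but it is compact in `D`, so the integrand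
is bounded uniformly in `t`. -/
theorem differentiableOn_weightPart (hρ : Continuous ρ) (hD : IsQuasiReinhardt ρ D)
    {φ : (Fin n → ℂ) → ℂ} (hφ : DifferentiableOn ℂ φ D) (k : Fin r → ℤ) :
    DifferentiableOn ℂ (weightPart ρ k φ) D := by
  intro z₀ hz₀
  apply DifferentiableAt.differentiableWithinAt
  obtain ⟨R, hR, hRD⟩ := Metric.nhds_basis_closedBall.mem_iff.1 (hD.isOpen.mem_nhds hz₀)
  have hK : IsCompact ((univ : Set (Torus r)) ×ˢ Metric.closedBall z₀ R) :=
    isCompact_univ.prod (isCompact_closedBall z₀ R)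
  have hc : ContinuousOn (fun q : Torus r × (Fin n → ℂ) => φ (act ρ q.1 q.2))
      ((univ : Set (Torus r)) ×ˢ Metric.closedBall z₀ R) :=
    hφ.continuousOn.comp (continuous_act hρ).continuousOn
      fun q hq => hD.invariant _ _ (hRD hq.2)
  obtain ⟨M, hM⟩ := hK.exists_bound_of_continuousOn hc
  have hM' : ∀ z ∈ Metric.ball z₀ R, ∀ t : Torus r, ‖φ (act ρ t z)‖ ≤ M := fun z hz t =>
    hM (t, z) ⟨mem_univ _, Metric.ball_subset_closedBall hz⟩
  refine differentiableAt_integral_of_bounded (R := R) (M := M) hR ?_ ?_ ?_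
  · intro z hz
    exact (integrable_weightPart hρ hD hφ.continuousOn
      (hRD (Metric.ball_subset_closedBall hz)) k).aestronglyMeasurable
  · intro t
    refine DifferentiableOn.const_mul ?_ _
    exact hφ.comp (actCLM ρ t).differentiable.differentiableOn
      fun z hz => hD.invariant _ _ (hRD (Metric.ball_subset_closedBall hz))
  · intro z hz t
    rw [norm_mul, norm_torusChar, one_mul]
    exact hM' z hz t

/-- Compactness of the torus times the unit ball, then scaling. -/
theorem exists_norm_act_le (hρ : Continuous ρ) :
    ∃ C > 0, ∀ (t : Torus r) (z : Fin n → ℂ), ‖act ρ t z‖ ≤ C * ‖z‖ := by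
  have hK : IsCompact ((univ : Set (Torus r)) ×ˢ Metric.closedBall (0 : Fin n → ℂ) 1) :=
    isCompact_univ.prod (isCompact_closedBall 0 1)
  obtain ⟨C, hC⟩ := hK.exists_bound_of_continuousOn (continuous_act hρ).continuousOn
  refine ⟨max C 1, by positivity, fun t z => ?_⟩
  refine le_trans ?_ (mul_le_mul_of_nonneg_right (le_max_left C 1) (norm_nonneg z))
  rcases eq_or_ne z 0 with rfl | hz
  · have : act ρ t 0 = 0 := (actCLM ρ t).map_zero
    simp [this]
  · have hz' : ‖z‖ ≠ 0 := norm_ne_zero_iff.2 hz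
    have h1 := hC (t, ((‖z‖⁻¹ : ℝ) : ℂ) • z) ⟨mem_univ _, by simp [norm_smul, hz']⟩
    simp only at h1
    rw [← actCLM_apply, map_smul, norm_smul, actCLM_apply] at h1
    simp only [Complex.norm_real, norm_inv, norm_norm] at h1
    rwa [inv_mul_le_iff₀ (norm_pos_iff.2 hz), mul_comm] at h1

/-- Taking weight components preserves the order of vanishing at the origin. -/
theorem isBigO_weightPart (hρ : Continuous ρ) {φ : (Fin n → ℂ) → ℂ} {m : ℕ}
    (hφ : φ =O[𝓝 0] fun z => ‖z‖ ^ m) (k : Fin r → ℤ) :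
    weightPart ρ k φ =O[𝓝 0] fun z => ‖z‖ ^ m := by
  obtain ⟨C, hC, hact⟩ := exists_norm_act_le hρ
  obtain ⟨A, hA⟩ := hφ.bound
  obtain ⟨ε, hε, hball⟩ := Metric.eventually_nhds_iff_ball.1 hA
  refine IsBigO.of_bound (|A| * C ^ m) ?_
  filter_upwards [Metric.ball_mem_nhds (0 : Fin n → ℂ) (div_pos hε hC)] with z hz
  rw [mem_ball_zero_iff, lt_div_iff₀ hC] at hz
  have h1 : ∀ t : Torus r, ‖torusChar (-k) t * φ (act ρ t z)‖ ≤ |A| * C ^ m * ‖z‖ ^ m := by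
    intro t
    rw [norm_mul, norm_torusChar, one_mul]
    have h2 := hact t z
    have h3 := hball (act ρ t z) (by rw [mem_ball_zero_iff]; linarith)
    rw [norm_pow, norm_norm] at h3
    calc _ ≤ A * ‖act ρ t z‖ ^ m := h3
      _ ≤ |A| * ‖act ρ t z‖ ^ m := by gcongr; exact le_abs_self A
      _ ≤ |A| * (C * ‖z‖) ^ m := by gcongr
      _ = _ := by ring
  have := norm_integral_le_of_norm_le_const (μ := torusHaar r) (Eventually.of_forall h1)
  simpa [weightPart] using this

theorem exists_weightPoly_weightPart (hρ : Continuous ρ) (hb : IsWeightBasis ρ b a)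
    (hpos : ∀ α : Fin n → ℕ, monomialWeight a α = 0 → α = 0)
    (hD : IsQuasiReinhardt ρ D) (h0 : (0 : Fin n → ℂ) ∈ D) {φ : (Fin n → ℂ) → ℂ}
    (hφ : DifferentiableOn ℂ φ D) (k : Fin r → ℤ) :
    ∃ p ∈ weightPolys b a k, ∀ z ∈ D, weightPart ρ k φ z = MvPolynomial.eval z p :=
  exists_weightPoly hb hpos hD h0 (differentiableOn_weightPart hρ hD hφ k)
    fun t z _ => weightPart_act k φ t z

theorem weightPart_eval (hb : IsWeightBasis ρ b a) {k : Fin r → ℤ} {p : MvPolynomial (Fin n) ℂ}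
    (hp : p ∈ weightPolys b a k) (l : Fin r → ℤ) (z : Fin n → ℂ) :
    weightPart ρ l (fun z => MvPolynomial.eval z p) z =
      if l = k then MvPolynomial.eval z p else 0 := by
  have h : weightPart ρ l (fun z => MvPolynomial.eval z p) z =
      (∫ t, torusChar (k - l) t ∂(torusHaar r)) * MvPolynomial.eval z p := by
    rw [weightPart, ← integral_mul_const]
    refine integral_congr_ae (Eventually.of_forall fun t => ?_)
    simp only [hb.eval_act hp, sub_eq_add_neg, torusChar_add]
    ring
  rw [h]
  split_ifs with hkl
  · simp [hkl]
  · rw [integral_torusChar_eq_zero (sub_ne_zero.2 (Ne.symm hkl)), zero_mul]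

/-- A holomorphic function with finitely many nonzero weight components is their sum. -/
theorem eq_sum_weightPart (hρ : Continuous ρ) (hb : IsWeightBasis ρ b a)
    (hD : IsQuasiReinhardt ρ D) {φ : (Fin n → ℂ) → ℂ} (hφ : DifferentiableOn ℂ φ D)
    {p : (Fin r → ℤ) → MvPolynomial (Fin n) ℂ} (hp : ∀ k, p k ∈ weightPolys b a k)
    (hpφ : ∀ k, ∀ z ∈ D, weightPart ρ k φ z = MvPolynomial.eval z (p k))
    {K : Finset (Fin r → ℤ)} (hK : ∀ k ∉ K, p k = 0) {z : Fin n → ℂ} (hz : z ∈ D) :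
    φ z = MvPolynomial.eval z (∑ k ∈ K, p k) := by
  classical
  have hc : ∀ k, Continuous fun t : Torus r => MvPolynomial.eval (act ρ t z) (p k) := fun k =>
    (differentiable_eval (p k)).continuous.comp (continuous_orbit hρ z)
  have hint : ∀ k l : Fin r → ℤ, Integrable
      (fun t : Torus r => torusChar (-l) t * MvPolynomial.eval (act ρ t z) (p k)) (torusHaar r) :=
    fun k l => ((continuous_torusChar _).mul (hc k)).integrable_of_hasCompactSupport
      (HasCompactSupport.of_compactSpace _)
  -- The difference of the two sides along the orbit of `z` has zero Fourier coefficients; the claim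
  -- is its value at `t = 1`.
  have h := eq_zero_of_fourier_eq_zero (r := r)
    (F := fun t => φ (act ρ t z) - ∑ k ∈ K, MvPolynomial.eval (act ρ t z) (p k))
    ((continuous_comp_orbit hρ hD hφ.continuousOn hz).sub
      (continuous_finsetSum _ fun k _ => hc k)) (fun l => ?_) 1
  · rw [act_one, sub_eq_zero] at h
    rw [h, map_sum]
  · simp only [mul_sub, Finset.mul_sum]
    rw [integral_sub (integrable_weightPart hρ hD hφ.continuousOn hz l)
      (integrable_finsetSum _ fun k _ => hint k l), integral_finsetSum _ fun k _ => hint k l]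
    have h1 := hpφ l z hz
    have h2 : ∀ k, ∫ t, torusChar (-l) t * MvPolynomial.eval (act ρ t z) (p k) ∂(torusHaar r) =
        if l = k then MvPolynomial.eval z (p k) else 0 := fun k => weightPart_eval hb (hp k) l z
    rw [weightPart] at h1
    rw [h1, Finset.sum_congr rfl fun k _ => h2 k, Finset.sum_ite_eq]
    split_ifs with hl
    · rw [sub_self]
    · rw [hK l hl, map_zero, sub_zero]

end WeightComponents

/-! ### Orthogonality of weights and the constant Jacobian. -/

section Integrals

open Set Filter Topology Asymptotics ComplexConjugate

variable {r n : ℕ} {b : Module.Basis (Fin n) ℂ (Fin n → ℂ)} {a : Fin n → Fin r → ℤ}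
  {ρ : Torus r →* Matrix.GeneralLinearGroup (Fin n) ℂ} {D : Set (Fin n → ℂ)}

/-- The complex Jacobian determinant. -/
noncomputable def jacobian (f : (Fin n → ℂ) → (Fin n → ℂ)) (z : Fin n → ℂ) : ℂ :=
  LinearMap.det (fderiv ℂ f z : (Fin n → ℂ) →ₗ[ℂ] (Fin n → ℂ))

/-- The real determinant is the norm from `ℂ` to `ℝ` of the complex one. -/
theorem abs_det_restrictScalars (L : (Fin n → ℂ) →L[ℂ] (Fin n → ℂ)) :
    |(L.restrictScalars ℝ).det| = ‖LinearMap.det (L : (Fin n → ℂ) →ₗ[ℂ] (Fin n → ℂ))‖ ^ 2 := by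
  have h : (L.restrictScalars ℝ).det =
      LinearMap.det ((L : (Fin n → ℂ) →ₗ[ℂ] (Fin n → ℂ)).restrictScalars ℝ) := rfl
  rw [h, LinearMap.det_restrictScalars, Algebra.norm_complex_apply, Complex.normSq_eq_norm_sq,
    abs_of_nonneg (by positivity)]

section ChangeOfVariables

variable {F : Type*} [NormedAddCommGroup F] [NormedSpace ℝ F]
  {f : (Fin n → ℂ) → (Fin n → ℂ)}

theorem hasFDerivWithinAt_restrictScalars (hD : IsOpen D) (hf : DifferentiableOn ℂ f D) :
    ∀ z ∈ D, HasFDerivWithinAt f ((fderiv ℂ f z).restrictScalars ℝ) D z := fun _ hz =>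
  ((hf.differentiableAt (hD.mem_nhds hz)).hasFDerivAt.restrictScalars ℝ).hasFDerivWithinAt

theorem setIntegral_eq_of_bijOn (hD : IsOpen D) (hf : DifferentiableOn ℂ f D)
    (hbij : BijOn f D D) (G : (Fin n → ℂ) → F) :
    ∫ z in D, G z = ∫ z in D, ‖jacobian f z‖ ^ 2 • G (f z) := by
  have h := integral_image_eq_integral_abs_det_fderiv_smul volume hD.measurableSet
    (hasFDerivWithinAt_restrictScalars hD hf) hbij.injOn G
  rw [hbij.image_eq] at h
  simpa only [abs_det_restrictScalars, jacobian] using h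

theorem integrableOn_iff_of_bijOn (hD : IsOpen D) (hf : DifferentiableOn ℂ f D)
    (hbij : BijOn f D D) (G : (Fin n → ℂ) → F) :
    IntegrableOn G D ↔ IntegrableOn (fun z => ‖jacobian f z‖ ^ 2 • G (f z)) D := by
  have h := integrableOn_image_iff_integrableOn_abs_det_fderiv_smul volume hD.measurableSet
    (hasFDerivWithinAt_restrictScalars hD hf) hbij.injOn G
  rw [hbij.image_eq] at h
  simpa only [abs_det_restrictScalars, jacobian] using h

end ChangeOfVariables

theorem differentiableOn_jacobian (hD : IsOpen D) {f : (Fin n → ℂ) → (Fin n → ℂ)}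
    (hf : DifferentiableOn ℂ f D) : DifferentiableOn ℂ (jacobian f) D := by
  have h : ∀ z ∈ D, jacobian f z =
      (Matrix.of fun i j => fderiv ℂ (fun z => f z i) z (Pi.single j 1)).det := by
    intro z hz
    rw [jacobian, ← LinearMap.det_toMatrix']
    congr 1
    ext i j
    have hfz := hf.differentiableAt (hD.mem_nhds hz)
    have h1 := (hasFDerivAt_pi'.1 hfz.hasFDerivAt i).fderiv
    rw [LinearMap.toMatrix'_apply, Matrix.of_apply, h1]
    simp [Pi.single]
  refine DifferentiableOn.congr ?_ h
  simp only [Matrix.det_apply', Matrix.of_apply]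
  refine DifferentiableOn.fun_sum fun σ _ => ?_
  have h1 : DifferentiableOn ℂ
      (fun z => ∏ j, fderiv ℂ (fun z => f z (σ j)) z (Pi.single j 1)) D := fun z hz =>
    (HasFDerivWithinAt.finsetProd fun j _ =>
      (differentiableOn_fderiv_apply hD (differentiableOn_pi.1 hf (σ j)) (Pi.single j 1) z
        hz).hasFDerivWithinAt).differentiableWithinAt
  exact h1.const_mul _

theorem jacobian_mul_jacobian (hD : IsOpen D) {f g : (Fin n → ℂ) → (Fin n → ℂ)}
    (hf : DifferentiableOn ℂ f D) (hg : DifferentiableOn ℂ g D) (hgD : MapsTo g D D)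
    (hfg : ∀ z ∈ D, f (g z) = z) {z : Fin n → ℂ} (hz : z ∈ D) :
    jacobian f (g z) * jacobian g z = 1 := by
  have h1 := (hf.differentiableAt (hD.mem_nhds (hgD hz))).hasFDerivAt
  have h2 := (hg.differentiableAt (hD.mem_nhds hz)).hasFDerivAt
  have h3 : HasFDerivAt (f ∘ g) (ContinuousLinearMap.id ℂ (Fin n → ℂ)) z := by
    refine (hasFDerivAt_id z).congr_of_eventuallyEq ?_
    filter_upwards [hD.mem_nhds hz] with w hw using hfg w hw
  have h4 := (h1.comp z h2).unique h3
  have h5 := congrArg (fun L : (Fin n → ℂ) →L[ℂ] (Fin n → ℂ) =>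
    LinearMap.det (L : (Fin n → ℂ) →ₗ[ℂ] (Fin n → ℂ))) h4
  simpa [jacobian, LinearMap.det_comp] using h5

theorem volume_real_pos (hD : IsOpen D) (h0 : (0 : Fin n → ℂ) ∈ D)
    (hbdd : Bornology.IsBounded D) : 0 < volume.real D :=
  ENNReal.toReal_pos (hD.measure_pos volume ⟨0, h0⟩).ne' hbdd.measure_lt_top.ne

theorem integrableOn_of_bounded (hD : IsOpen D) (hbdd : Bornology.IsBounded D)
    {φ : (Fin n → ℂ) → ℂ} (hφ : ContinuousOn φ D) {M : ℝ} (hM : ∀ z ∈ D, ‖φ z‖ ≤ M) :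
    IntegrableOn φ D := by
  have : IsFiniteMeasure (volume.restrict D) := ⟨by simpa using hbdd.measure_lt_top⟩
  refine Integrable.of_bound (hφ.aestronglyMeasurable hD.measurableSet) M ?_
  exact (ae_restrict_iff' hD.measurableSet).2 (Eventually.of_forall hM)

theorem eqOn_zero_of_setIntegral_norm_sq (hD : IsOpen D) {φ : (Fin n → ℂ) → ℂ}
    (hφ : ContinuousOn φ D) (hint : IntegrableOn (fun z => ‖φ z‖ ^ 2) D)
    (h : ∫ z in D, ‖φ z‖ ^ 2 = 0) : ∀ z ∈ D, φ z = 0 := by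
  rw [integral_eq_zero_iff_of_nonneg (fun z => by positivity) hint] at h
  have h1 := Measure.eqOn_open_of_ae_eq h hD (hφ.norm.pow 2) continuousOn_const
  intro z hz
  simpa using h1 hz

theorem bijOn_act (hD : IsQuasiReinhardt ρ D) (t : Torus r) : BijOn (act ρ t) D D :=
  InvOn.bijOn (f' := act ρ t⁻¹)
    ⟨fun z _ => by rw [← act_mul, inv_mul_cancel, act_one],
      fun z _ => by rw [← act_mul, mul_inv_cancel, act_one]⟩
    (fun z hz => hD.invariant t z hz) (fun z hz => hD.invariant _ z hz)

theorem differentiable_act (t : Torus r) : Differentiable ℂ (act ρ t) :=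
  (actCLM ρ t).differentiable

/-- The map is linear, so its Jacobian is constant; it maps `D`, of finite positive volume, onto
itself. -/
theorem norm_jacobian_act (hD : IsQuasiReinhardt ρ D) (h0 : (0 : Fin n → ℂ) ∈ D)
    (hbdd : Bornology.IsBounded D) (t : Torus r) (z : Fin n → ℂ) :
    ‖jacobian (act ρ t) z‖ ^ 2 = 1 := by
  have hconst : ∀ w, jacobian (act ρ t) w = jacobian (act ρ t) z := by
    intro w
    have h : ∀ w, fderiv ℂ (act ρ t) w = actCLM ρ t := fun w => (actCLM ρ t).fderiv
    simp only [jacobian, h]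
  have h := setIntegral_eq_of_bijOn hD.isOpen (differentiable_act t).differentiableOn
    (bijOn_act hD t) (fun _ => (1 : ℝ))
  simp only [hconst, smul_eq_mul, mul_one, setIntegral_const] at h
  have hv := volume_real_pos hD.isOpen h0 hbdd
  nlinarith

theorem setIntegral_comp_act {F : Type*} [NormedAddCommGroup F] [NormedSpace ℝ F]
    (hD : IsQuasiReinhardt ρ D) (h0 : (0 : Fin n → ℂ) ∈ D)
    (hbdd : Bornology.IsBounded D) (t : Torus r) (G : (Fin n → ℂ) → F) :
    ∫ z in D, G (act ρ t z) = ∫ z in D, G z := by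
  rw [setIntegral_eq_of_bijOn hD.isOpen (differentiable_act t).differentiableOn
    (bijOn_act hD t) G]
  simp only [norm_jacobian_act hD h0 hbdd, one_smul]

theorem integrableOn_comp_act (hD : IsQuasiReinhardt ρ D) (h0 : (0 : Fin n → ℂ) ∈ D)
    (hbdd : Bornology.IsBounded D) (t : Torus r) {G : (Fin n → ℂ) → ℂ} (hG : IntegrableOn G D) :
    IntegrableOn (fun z => G (act ρ t z)) D := by
  have h := (integrableOn_iff_of_bijOn hD.isOpen (differentiable_act t).differentiableOn
    (bijOn_act hD t) G).1 hG
  simpa only [norm_jacobian_act hD h0 hbdd, one_smul] using h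

/-- In an inner product with a function of weight `k`, only the component of weight `k` counts. -/
theorem setIntegral_mul_conj (hρ : Continuous ρ) (hD : IsQuasiReinhardt ρ D)
    (h0 : (0 : Fin n → ℂ) ∈ D) (hbdd : Bornology.IsBounded D)
    {φ ψ : (Fin n → ℂ) → ℂ} (hφ : ContinuousOn φ D) (hφi : IntegrableOn φ D)
    (hψ : ContinuousOn ψ D) {M : ℝ} (hM : ∀ z ∈ D, ‖ψ z‖ ≤ M) {k : Fin r → ℤ}
    (hk : ∀ t : Torus r, ∀ z ∈ D, ψ (act ρ t z) = torusChar k t * ψ z) :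
    ∫ z in D, φ z * conj (ψ z) = ∫ z in D, weightPart ρ k φ z * conj (ψ z) := by
  -- On `D`, `F t` is `φ * conj ψ` composed with `ρ(t)`, so its integral is independent of `t`.
  -- Integrating over `t` first instead yields `weightPart`.
  let F : Torus r → (Fin n → ℂ) → ℂ := fun t z =>
    torusChar (-k) t * φ (act ρ t z) * conj (ψ z)
  have hF : ∀ t, ∀ z ∈ D, F t z = φ (act ρ t z) * conj (ψ (act ρ t z)) := by
    intro t z hz
    rw [hk t z hz, map_mul, conj_torusChar]
    simp only [F]
    ring
  have hcψ : ContinuousOn (fun z => conj (ψ z)) D := Complex.continuous_conj.comp_continuousOn hψ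
  have hH : IntegrableOn (fun z => φ z * conj (ψ z)) D := by
    refine Integrable.mul_bdd (c := M) hφi (hcψ.aestronglyMeasurable hD.isOpen.measurableSet) ?_
    refine (ae_restrict_iff' hD.isOpen.measurableSet).2 (Eventually.of_forall fun z hz => ?_)
    rw [RCLike.norm_conj]
    exact hM z hz
  have hFint : ∀ t, IntegrableOn (F t) D := fun t =>
    (integrableOn_congr_fun (hF t) hD.isOpen.measurableSet).2
      (integrableOn_comp_act hD h0 hbdd t hH)
  have hmeas : AEStronglyMeasurable (Function.uncurry F)
      ((torusHaar r).prod (volume.restrict D)) := by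
    have h1 : (torusHaar r).prod (volume.restrict D) =
        ((torusHaar r).prod volume).restrict (univ ×ˢ D) := by
      rw [← Measure.prod_restrict, Measure.restrict_univ]
    rw [h1]
    refine ContinuousOn.aestronglyMeasurable ?_
      (MeasurableSet.univ.prod hD.isOpen.measurableSet)
    refine ContinuousOn.mul (ContinuousOn.mul ?_ ?_) ?_
    · exact ((continuous_torusChar _).comp continuous_fst).continuousOn
    · exact hφ.comp (continuous_act hρ).continuousOn fun q hq => hD.invariant _ _ hq.2
    · exact hcψ.comp continuous_snd.continuousOn fun q hq => hq.2
  have hFprod : Integrable (Function.uncurry F) ((torusHaar r).prod (volume.restrict D)) := by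
    rw [integrable_prod_iff hmeas]
    refine ⟨Eventually.of_forall hFint, ?_⟩
    have h1 : ∀ t, ∫ z in D, ‖F t z‖ = ∫ z in D, ‖φ z * conj (ψ z)‖ := by
      intro t
      rw [← setIntegral_comp_act hD h0 hbdd t fun z => ‖φ z * conj (ψ z)‖]
      exact setIntegral_congr_fun hD.isOpen.measurableSet fun z hz => by simp only [hF t z hz]
    simp only [Function.uncurry_apply_pair, h1]
    exact integrable_const _
  calc ∫ z in D, φ z * conj (ψ z)
      = ∫ _t : Torus r, (∫ z in D, φ z * conj (ψ z)) ∂(torusHaar r) := by simp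
    _ = ∫ t, (∫ z in D, F t z) ∂(torusHaar r) := by
        refine integral_congr_ae (Eventually.of_forall fun t => ?_)
        simp only
        rw [← setIntegral_comp_act hD h0 hbdd t fun z => φ z * conj (ψ z)]
        exact (setIntegral_congr_fun hD.isOpen.measurableSet (hF t)).symm
    _ = ∫ z in D, ∫ t, F t z ∂(torusHaar r) := integral_integral_swap hFprod
    _ = _ := by
        refine integral_congr_ae (Eventually.of_forall fun z => ?_)
        simp only [F, weightPart, integral_mul_const]

/-- The mean value property at the origin. -/
theorem setIntegral_eq_volume_mul (hρ : Continuous ρ) (hb : IsWeightBasis ρ b a)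
    (hpos : ∀ α : Fin n → ℕ, monomialWeight a α = 0 → α = 0)
    (hD : IsQuasiReinhardt ρ D) (h0 : (0 : Fin n → ℂ) ∈ D) (hbdd : Bornology.IsBounded D)
    {φ : (Fin n → ℂ) → ℂ} (hφ : DifferentiableOn ℂ φ D) (hφi : IntegrableOn φ D) :
    ∫ z in D, φ z = volume.real D * φ 0 := by
  -- Pairing with the constant `1`, of weight `0`, leaves the component of weight `0`, which is a
  -- constant polynomial.
  have h1 := setIntegral_mul_conj (ψ := fun _ => 1) (k := 0) (M := 1) hρ hD h0 hbdd
    hφ.continuousOn hφi continuousOn_const (by simp) (by simp)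
  simp only [map_one, mul_one] at h1
  obtain ⟨p, hp, hpe⟩ := exists_weightPoly_weightPart hρ hb hpos hD h0 hφ 0
  have hdeg : p.totalDegree = 0 := by
    have := totalDegree_le_of_mem_weightPolys (N := 0) (fun α hα => by simp [hpos α hα]) hp
    omega
  have hconst : ∀ z ∈ D, weightPart ρ 0 φ z = φ 0 := by
    intro z hz
    rw [← weightPart_zero (ρ := ρ) 0 φ rfl, hpe z hz, hpe 0 h0,
      MvPolynomial.totalDegree_eq_zero_iff_eq_C.1 hdeg]
    simp
  rw [h1, setIntegral_congr_fun hD.isOpen.measurableSet hconst, setIntegral_const]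
  simp

/-- The Jacobian determinant of an automorphism fixing the origin is constant. -/
theorem jacobian_eq_const (hρ : Continuous ρ) (hb : IsWeightBasis ρ b a)
    (hpos : ∀ α : Fin n → ℕ, monomialWeight a α = 0 → α = 0)
    (hD : IsQuasiReinhardt ρ D) (h0 : (0 : Fin n → ℂ) ∈ D) (hbdd : Bornology.IsBounded D)
    {f g : (Fin n → ℂ) → (Fin n → ℂ)} (hf : DifferentiableOn ℂ f D) (hfD : MapsTo f D D)
    (hg : DifferentiableOn ℂ g D) (hgD : MapsTo g D D) (hinvOn : InvOn g f D D)
    (hf0 : f 0 = 0) : ∀ z ∈ D, jacobian f z = jacobian f 0 := by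
  have hDm := hD.isOpen.measurableSet
  have hfin : IsFiniteMeasure (volume.restrict D) := ⟨by simpa using hbdd.measure_lt_top⟩
  have hJ := differentiableOn_jacobian hD.isOpen hf
  have hJg := differentiableOn_jacobian hD.isOpen hg
  have hg0 : g 0 = 0 := by have := hinvOn.1 h0; rwa [hf0] at this
  have hbf : BijOn f D D := hinvOn.bijOn hfD hgD
  have hbg : BijOn g D D := hinvOn.symm.bijOn hgD hfD
  -- The aim is `∫ ‖χ‖² = ∫ conj(J_f) χ - conj(J_f(0)) ∫ χ = 0`; note `χ 0 = 0`.
  set χ : (Fin n → ℂ) → ℂ := fun z => jacobian f z - jacobian f 0 with hχ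
  have hχd : DifferentiableOn ℂ χ D := hJ.sub (differentiableOn_const _)
  -- `‖J_f‖²` is the real Jacobian, so its integral over `D` is the volume of `f(D) = D`.
  have hJ2 : IntegrableOn (fun z => ‖jacobian f z‖ ^ 2) D := by
    have h1 := (integrableOn_iff_of_bijOn hD.isOpen hf hbf fun _ => (1 : ℝ)).1
      (integrable_const _)
    simpa only [smul_eq_mul, mul_one] using h1
  have hJ1 : IntegrableOn (jacobian f) D := by
    refine Integrable.mono' ((integrable_const (1 : ℝ)).add hJ2)
      (hJ.continuousOn.aestronglyMeasurable hDm) (Eventually.of_forall fun z => ?_)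
    simp only [Pi.add_apply]
    nlinarith [sq_nonneg (‖jacobian f z‖ - 1)]
  have hχi : IntegrableOn χ D := hJ1.sub (integrable_const _)
  have hJc : IntegrableOn (fun z => conj (jacobian f z)) D := by
    refine hJ1.norm.mono' ((Complex.continuous_conj.comp_continuousOn
      hJ.continuousOn).aestronglyMeasurable hDm) (Eventually.of_forall fun z => ?_)
    rw [RCLike.norm_conj]
  have hJχ : IntegrableOn (fun z => conj (jacobian f z) * χ z) D := by
    have h1 : (fun z => conj (jacobian f z) * χ z) = fun z =>
        ((‖jacobian f z‖ ^ 2 : ℝ) : ℂ) - conj (jacobian f z) * jacobian f 0 := by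
      funext z
      simp only [hχ, mul_sub, Complex.conj_mul']
      push_cast
      ring
    rw [h1]
    exact hJ2.ofReal.sub (hJc.mul_const _)
  -- Since `J_f(g w) J_g(w) = 1`, the substitution `z = g(w)` turns a non-holomorphic integrand into
  -- a holomorphic one that vanishes at `0`.
  have hcov : ∀ w ∈ D, ‖jacobian g w‖ ^ 2 • (conj (jacobian f (g w)) * χ (g w)) =
      jacobian g w * χ (g w) := by
    intro w hw
    have h1 := jacobian_mul_jacobian hD.isOpen hf hg hgD hinvOn.2 hw
    have h2 : conj (jacobian f (g w)) * conj (jacobian g w) = 1 := by rw [← map_mul, h1, map_one]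
    rw [Complex.real_smul, Complex.ofReal_pow, ← Complex.conj_mul']
    linear_combination (jacobian g w * χ (g w)) * h2
  have hI1 : ∫ z in D, conj (jacobian f z) * χ z = 0 := by
    rw [setIntegral_eq_of_bijOn hD.isOpen hg hbg, setIntegral_congr_fun hDm hcov,
      setIntegral_eq_volume_mul hρ hb hpos hD h0 hbdd (hJg.fun_mul (hχd.fun_comp hg hgD))]
    · simp [hg0, hχ]
    · refine (integrableOn_congr_fun hcov hDm).1 ?_
      exact (integrableOn_iff_of_bijOn hD.isOpen hg hbg fun z =>
        conj (jacobian f z) * χ z).1 hJχ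
  have hI2 : ∫ z in D, conj (jacobian f 0) * χ z = 0 := by
    rw [integral_const_mul, setIntegral_eq_volume_mul hρ hb hpos hD h0 hbdd hχd hχi]
    simp [hχ]
  have hnorm : ∀ z, ((‖χ z‖ ^ 2 : ℝ) : ℂ) =
      conj (jacobian f z) * χ z - conj (jacobian f 0) * χ z := by
    intro z
    rw [Complex.ofReal_pow, ← Complex.conj_mul', ← sub_mul, ← map_sub]
  have hχ2 : IntegrableOn (fun z => ((‖χ z‖ ^ 2 : ℝ) : ℂ)) D := by
    simp only [hnorm]
    exact hJχ.sub (hχi.const_mul _)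
  have hzero := eqOn_zero_of_setIntegral_norm_sq hD.isOpen hχd.continuousOn
    (by simpa only [IntegrableOn, RCLike.re_to_complex, Complex.ofReal_re] using hχ2.re) (by
      have h1 : ((∫ z in D, ‖χ z‖ ^ 2 : ℝ) : ℂ) = 0 := by
        rw [← integral_complex_ofReal]
        simp only [hnorm]
        rw [integral_sub hJχ (hχi.const_mul _), hI1, hI2, sub_zero]
      exact_mod_cast h1)
  intro z hz
  exact sub_eq_zero.1 (hzero z hz)

theorem exists_bound_of_continuous (hbdd : Bornology.IsBounded D) {φ : (Fin n → ℂ) → ℂ}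
    (hφ : Continuous φ) : ∃ M, ∀ z ∈ D, ‖φ z‖ ≤ M := by
  obtain ⟨M, hM⟩ := hbdd.isCompact_closure.exists_bound_of_continuousOn hφ.continuousOn
  exact ⟨M, fun z hz => hM z (subset_closure hz)⟩

theorem differentiable_coord (i : Fin n) : Differentiable ℂ fun z => b.equivFun z i :=
  (LinearMap.toContinuousLinearMap (b.coord i)).differentiable

/-- The `i`-th component of an automorphism fixing the origin has no component of weight `k` if
all monomials of weight `k` have degree greater than those of weight `a_i`. -/
theorem weightPart_component_eq_zero (hρ : Continuous ρ) (hb : IsWeightBasis ρ b a)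
    (hpos : ∀ α : Fin n → ℕ, monomialWeight a α = 0 → α = 0)
    (hD : IsQuasiReinhardt ρ D) (h0 : (0 : Fin n → ℂ) ∈ D) (hbdd : Bornology.IsBounded D)
    {f : (Fin n → ℂ) → (Fin n → ℂ)} (hf : IsAutomorphism D f) (hf0 : f 0 = 0)
    {i : Fin n} {k : Fin r → ℤ} {m : ℕ}
    (hm : ∀ α, monomialWeight a α = a i → ∑ l, α l ≤ m)
    (hk : ∀ α, monomialWeight a α = k → m + 1 ≤ ∑ l, α l) :
    ∀ z ∈ D, weightPart ρ k (fun z => b.equivFun (f z) i) z = 0 := by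
  obtain ⟨hfd, hfD, g, hg, hgD, hinvOn⟩ := hf
  have hDm := hD.isOpen.measurableSet
  have hJ := jacobian_eq_const hρ hb hpos hD h0 hbdd hfd hfD hg hgD hinvOn hf0
  have hg0 : g 0 = 0 := by have := hinvOn.1 h0; rwa [hf0] at this
  have hbf : BijOn f D D := hinvOn.bijOn hfD hgD
  have hJ0 : jacobian f 0 ≠ 0 := by
    have := jacobian_mul_jacobian hD.isOpen hfd hg hgD hinvOn.2 h0
    rw [hg0] at this
    exact left_ne_zero_of_mul_eq_one this
  have hfi : DifferentiableOn ℂ (fun z => b.equivFun (f z) i) D :=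
    (differentiable_coord i).comp_differentiableOn hfd
  obtain ⟨p, hp, hpe⟩ := exists_weightPoly_weightPart hρ hb hpos hD h0 hfi k
  -- The test function is the weight `k` component of `f_i` itself, so `⟨f_i, ψ⟩` will equal `∫
  -- ‖ψ‖²`.
  set ψ : (Fin n → ℂ) → ℂ := fun z => MvPolynomial.eval z p with hψ
  have hψd : Differentiable ℂ ψ := differentiable_eval p
  obtain ⟨M, hM⟩ := exists_bound_of_continuous hbdd hψd.continuous
  obtain ⟨M', hM'⟩ := exists_bound_of_continuous hbdd (differentiable_coord (b := b) i).continuous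
  have hψg : DifferentiableOn ℂ (fun z => ψ (g z)) D := hψd.comp_differentiableOn hg
  have hOψg : (fun z => ψ (g z)) =O[𝓝 0] fun z => ‖z‖ ^ (m + 1) := by
    have hgd : DifferentiableAt ℂ g 0 := hg.differentiableAt (hD.isOpen.mem_nhds h0)
    have h1 : Tendsto g (𝓝 0) (𝓝 0) := by
      have := hgd.continuousAt.tendsto
      rwa [hg0] at this
    have h2 : g =O[𝓝 0] fun z => z := by
      have := hgd.hasFDerivAt.isBigO_sub
      simpa [hg0] using this
    exact ((isBigO_eval_of_mem_weightPolys hk hp).comp_tendsto h1).trans (h2.norm_norm.pow (m + 1))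
  obtain ⟨q, hq, hqe⟩ := exists_weightPoly_weightPart hρ hb hpos hD h0 hψg (a i)
  -- The weight `a_i` part of `ψ ∘ g` has degree at most `m` but vanishes to order `m + 1`.
  have hq0 : q = 0 := by
    refine eq_zero_of_totalDegree_le_of_isBigO (totalDegree_le_of_mem_weightPolys hm hq) ?_
    refine (isBigO_weightPart hρ hOψg (a i)).congr' ?_ EventuallyEq.rfl
    filter_upwards [hD.isOpen.mem_nhds h0] with z hz using hqe z hz
  have horth : ∫ z in D, ψ (g z) * conj (b.equivFun z i) = 0 := by
    rw [setIntegral_mul_conj hρ hD h0 hbdd hψg.continuousOn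
      (integrableOn_of_bounded hD.isOpen hbdd hψg.continuousOn fun z hz => hM _ (hgD hz))
      (differentiable_coord i).continuous.continuousOn hM'
      fun t z _ => hb.equivFun_act t z i]
    rw [setIntegral_congr_fun (g := fun _ => (0 : ℂ)) hDm fun z hz => by simp [hqe z hz, hq0]]
    simp
  have horth' : ∫ z in D, b.equivFun z i * conj (ψ (g z)) = 0 := by
    have h1 := congrArg conj horth
    rw [← integral_conj, map_zero] at h1
    simpa [mul_comm] using h1
  -- Substituting `f` turns `z_i` into `f_i` and `ψ ∘ g` into `ψ`; the constant factor `‖J_f‖²` is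
  -- nonzero and drops out.
  have hfψ : ∫ z in D, b.equivFun (f z) i * conj (ψ z) = 0 := by
    rw [setIntegral_eq_of_bijOn hD.isOpen hfd hbf] at horth'
    rw [setIntegral_congr_fun (g := fun z => (‖jacobian f 0‖ ^ 2) •
      (b.equivFun (f z) i * conj (ψ z))) hDm fun z hz => by
        simp only [hJ z hz, hinvOn.1 hz], integral_smul] at horth'
    exact (smul_eq_zero.1 horth').resolve_left (by simpa using hJ0)
  rw [setIntegral_mul_conj hρ hD h0 hbdd hfi.continuousOn
    (integrableOn_of_bounded hD.isOpen hbdd hfi.continuousOn fun z hz => hM' _ (hfD hz))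
    hψd.continuous.continuousOn hM fun t z _ => hb.eval_act hp t z,
    setIntegral_congr_fun (g := fun z => ((‖ψ z‖ ^ 2 : ℝ) : ℂ)) hDm fun z hz => by
      simp only [hpe z hz]
      rw [Complex.mul_conj']
      push_cast
      rfl, integral_complex_ofReal] at hfψ
  have hzero := eqOn_zero_of_setIntegral_norm_sq hD.isOpen hψd.continuous.continuousOn ?_
    (by exact_mod_cast hfψ)
  · intro z hz
    rw [hpe z hz]
    exact hzero z hz
  · have h1 := integrableOn_of_bounded (φ := fun z => ((‖ψ z‖ ^ 2 : ℝ) : ℂ)) (M := M ^ 2)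
      hD.isOpen hbdd (by
        have := hψd.continuous
        fun_prop) (fun z hz => by
        rw [Complex.norm_real, Real.norm_of_nonneg (by positivity)]
        exact pow_le_pow_left₀ (norm_nonneg _) (hM z hz) 2)
    simpa only [IntegrableOn, RCLike.re_to_complex, Complex.ofReal_re] using h1.re

end Integrals

/-! ### Degrees in the weight spaces and the quasi-resonance bounds. -/

section Degrees

open Set Filter Topology

variable {r n : ℕ} {b : Module.Basis (Fin n) ℂ (Fin n → ℂ)} {a : Fin n → Fin r → ℤ}
  {ρ : Torus r →* Matrix.GeneralLinearGroup (Fin n) ℂ} {D : Set (Fin n → ℂ)}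

/-- The polynomials in the weight space `V_k` are the combinations of monomials of weight `k`. -/
theorem eval_mem_weightSpace_iff (hb : IsWeightBasis ρ b a)
    (hpos : ∀ α : Fin n → ℕ, monomialWeight a α = 0 → α = 0)
    (hD : IsQuasiReinhardt ρ D) (h0 : (0 : Fin n → ℂ) ∈ D) (hbdd : Bornology.IsBounded D)
    (k : Fin r → ℤ) (p : MvPolynomial (Fin n) ℂ) :
    (fun z => MvPolynomial.eval z p) ∈ weightSpace ρ D k ↔ p ∈ weightPolys b a k := by
  constructor
  · rintro ⟨hd, -, hk⟩
    obtain ⟨q, hq, hpq⟩ := exists_weightPoly hb hpos hD h0 hd hk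
    rwa [eq_of_eval_eq_on hD.isOpen h0 hpq]
  · intro hp
    have hfin : IsFiniteMeasure (volume.restrict D) := ⟨by simpa using hbdd.measure_lt_top⟩
    have hd := differentiable_eval p
    obtain ⟨M, hM⟩ := exists_bound_of_continuous hbdd hd.continuous
    refine ⟨hd.differentiableOn, ?_, fun t z _ => hb.eval_act hp t z⟩
    refine MemLp.of_bound hd.continuous.aestronglyMeasurable M ?_
    exact (ae_restrict_iff' hD.isOpen.measurableSet).2 (Eventually.of_forall hM)

theorem mem_weightDegrees_iff (hb : IsWeightBasis ρ b a)
    (hpos : ∀ α : Fin n → ℕ, monomialWeight a α = 0 → α = 0)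
    (hD : IsQuasiReinhardt ρ D) (h0 : (0 : Fin n → ℂ) ∈ D) (hbdd : Bornology.IsBounded D)
    (k : Fin r → ℤ) (m : ℕ) :
    m ∈ weightDegrees ρ D k ↔ ∃ p ∈ weightPolys b a k, p ≠ 0 ∧ p.totalDegree = m := by
  constructor
  · rintro ⟨p, hp0, hp, hm⟩
    exact ⟨p, (eval_mem_weightSpace_iff hb hpos hD h0 hbdd k p).1 hp, hp0, hm⟩
  · rintro ⟨p, hp, hp0, hm⟩
    exact ⟨p, hp0, (eval_mem_weightSpace_iff hb hpos hD h0 hbdd k p).2 hp, hm⟩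

theorem sum_mem_weightDegrees (hb : IsWeightBasis ρ b a)
    (hpos : ∀ α : Fin n → ℕ, monomialWeight a α = 0 → α = 0)
    (hD : IsQuasiReinhardt ρ D) (h0 : (0 : Fin n → ℂ) ∈ D) (hbdd : Bornology.IsBounded D)
    (α : Fin n → ℕ) : ∑ i, α i ∈ weightDegrees ρ D (monomialWeight a α) :=
  (mem_weightDegrees_iff hb hpos hD h0 hbdd _ _).2
    ⟨_, basisMonomial_mem α, basisMonomial_ne_zero α, totalDegree_basisMonomial α⟩

theorem bddAbove_weightDegrees (hb : IsWeightBasis ρ b a)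
    (hpos : ∀ α : Fin n → ℕ, monomialWeight a α = 0 → α = 0)
    (hD : IsQuasiReinhardt ρ D) (h0 : (0 : Fin n → ℂ) ∈ D) (hbdd : Bornology.IsBounded D)
    (k : Fin r → ℤ) : BddAbove (weightDegrees ρ D k) := by
  obtain ⟨N, hN⟩ := exists_degree_bound hpos k
  refine ⟨N, fun m hm => ?_⟩
  obtain ⟨p, hp, -, rfl⟩ := (mem_weightDegrees_iff hb hpos hD h0 hbdd k m).1 hm
  exact totalDegree_le_of_mem_weightPolys hN hp

/-- The minimal degree `d_k` is attained by a monomial. -/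
theorem exists_monomial_of_minDeg_le (hb : IsWeightBasis ρ b a)
    (hpos : ∀ α : Fin n → ℕ, monomialWeight a α = 0 → α = 0)
    (hD : IsQuasiReinhardt ρ D) (h0 : (0 : Fin n → ℂ) ∈ D) (hbdd : Bornology.IsBounded D)
    {k : Fin r → ℤ} {m : ℕ} (hne : (weightDegrees ρ D k).Nonempty) (hm : minDeg ρ D k ≤ m) :
    ∃ α, monomialWeight a α = k ∧ ∑ i, α i ≤ m := by
  obtain ⟨p, hp, hp0, hpm⟩ :=
    (mem_weightDegrees_iff hb hpos hD h0 hbdd k _).1 (Nat.sInf_mem hne)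
  -- Otherwise a nonzero polynomial of degree at most `m` would vanish to order `m + 1`.
  by_contra! hall
  exact hp0 (eq_zero_of_totalDegree_le_of_isBigO (m := m) (hpm.le.trans hm)
    (isBigO_eval_of_mem_weightPolys hall hp))

/-- Every such weight is that of one of the finitely many monomials of degree at most `m`. This
makes the suprema over weights genuine maxima and not the default `0`. -/
theorem finite_setOf_minDeg_le (hb : IsWeightBasis ρ b a)
    (hpos : ∀ α : Fin n → ℕ, monomialWeight a α = 0 → α = 0)
    (hD : IsQuasiReinhardt ρ D) (h0 : (0 : Fin n → ℂ) ∈ D) (hbdd : Bornology.IsBounded D)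
    (m : ℕ) : {k | (weightDegrees ρ D k).Nonempty ∧ minDeg ρ D k ≤ m}.Finite := by
  have hfin : {α : Fin n → ℕ | ∑ i, α i ≤ m}.Finite := by
    refine (Set.finite_Iic (fun _ => m)).subset fun α hα i => ?_
    exact (Finset.single_le_sum (fun _ _ => Nat.zero_le _) (Finset.mem_univ i)).trans hα
  refine (hfin.image (monomialWeight a)).subset ?_
  rintro k ⟨hne, hk⟩
  obtain ⟨α, hα, hαm⟩ := exists_monomial_of_minDeg_le hb hpos hD h0 hbdd hne hk
  exact ⟨α, hαm, hα⟩

theorem maxDeg_le_maxDegUpTo (hb : IsWeightBasis ρ b a)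
    (hpos : ∀ α : Fin n → ℕ, monomialWeight a α = 0 → α = 0)
    (hD : IsQuasiReinhardt ρ D) (h0 : (0 : Fin n → ℂ) ∈ D) (hbdd : Bornology.IsBounded D)
    {k : Fin r → ℤ} {m : ℕ} (hne : (weightDegrees ρ D k).Nonempty) (hm : minDeg ρ D k ≤ m) :
    maxDeg ρ D k ≤ maxDegUpTo ρ D m := by
  refine le_csSup ?_ ⟨k, hne, hm, rfl⟩
  refine (((finite_setOf_minDeg_le hb hpos hD h0 hbdd m).image (maxDeg ρ D)).subset ?_).bddAbove
  rintro _ ⟨l, hl, hlm, rfl⟩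
  exact ⟨l, ⟨hl, hlm⟩, rfl⟩

theorem maxDegUpTo_mono (hb : IsWeightBasis ρ b a)
    (hpos : ∀ α : Fin n → ℕ, monomialWeight a α = 0 → α = 0)
    (hD : IsQuasiReinhardt ρ D) (h0 : (0 : Fin n → ℂ) ∈ D) (hbdd : Bornology.IsBounded D)
    {m m' : ℕ} (h : m ≤ m') : maxDegUpTo ρ D m ≤ maxDegUpTo ρ D m' := by
  -- For the empty set `sSup` is `0`.
  rcases Set.eq_empty_or_nonempty {d | ∃ k : Fin r → ℤ, (weightDegrees ρ D k).Nonempty ∧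
    minDeg ρ D k ≤ m ∧ maxDeg ρ D k = d} with he | hne
  · rw [maxDegUpTo, he]; simp
  · refine csSup_le hne ?_
    rintro _ ⟨k, hk, hkm, rfl⟩
    exact maxDeg_le_maxDegUpTo hb hpos hD h0 hbdd hk (hkm.trans h)

theorem monomialWeight_eq_iff_mem_resonanceSet (α : Fin n → ℕ) (i : Fin n) :
    monomialWeight a α = a i ↔ α ∈ resonanceSet a i := funext_iff

theorem bddAbove_resonance (hpos : ∀ α : Fin n → ℕ, monomialWeight a α = 0 → α = 0)
    (i : Fin n) : BddAbove {m | ∃ α ∈ resonanceSet a i, ∑ l, α l = m} := by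
  obtain ⟨N, hN⟩ := exists_degree_bound hpos (a i)
  refine ⟨N, ?_⟩
  rintro _ ⟨α, hα, rfl⟩
  exact hN α ((monomialWeight_eq_iff_mem_resonanceSet α i).2 hα)

theorem sum_le_resonanceOrderAt (hpos : ∀ α : Fin n → ℕ, monomialWeight a α = 0 → α = 0)
    {i : Fin n} {α : Fin n → ℕ} (hα : monomialWeight a α = a i) :
    ∑ l, α l ≤ resonanceOrderAt a i :=
  le_csSup (bddAbove_resonance hpos i)
    ⟨α, (monomialWeight_eq_iff_mem_resonanceSet α i).1 hα, rfl⟩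

/-- The coordinate `z_i` is an element of least degree in its weight space. -/
theorem minDeg_weight_eq_one (hb : IsWeightBasis ρ b a)
    (hpos : ∀ α : Fin n → ℕ, monomialWeight a α = 0 → α = 0)
    (hD : IsQuasiReinhardt ρ D) (h0 : (0 : Fin n → ℂ) ∈ D) (hbdd : Bornology.IsBounded D)
    (i : Fin n) : (weightDegrees ρ D (a i)).Nonempty ∧ minDeg ρ D (a i) = 1 := by
  classical
  have h1 : 1 ∈ weightDegrees ρ D (a i) := by
    have := sum_mem_weightDegrees hb hpos hD h0 hbdd (Pi.single i 1)
    rwa [monomialWeight_single, Finset.sum_pi_single', if_pos (Finset.mem_univ i)] at this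
  -- Degree `0` would force `a i = 0`, making the coordinate `z_i` a nonconstant invariant.
  refine ⟨⟨1, h1⟩, le_antisymm (Nat.sInf_le h1) ?_⟩
  by_contra hlt
  obtain ⟨α, hα, hα0⟩ := exists_monomial_of_minDeg_le hb hpos hD h0 hbdd ⟨1, h1⟩
    (show minDeg ρ D (a i) ≤ 0 by omega)
  have hαz : α = 0 := by
    funext l
    have := (Finset.single_le_sum (fun _ _ => Nat.zero_le _) (Finset.mem_univ l)).trans hα0
    simpa using this
  have hai : a i = 0 := by
    rw [← hα, hαz]; funext j; simp [monomialWeight]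
  have h2 := hpos (Pi.single i 1) (by rw [monomialWeight_single, hai])
  simpa using congrFun h2 i

/-- The monomials counted by `μ_i` lie in `V_{a_i}`, where the minimal degree is `1`, so `μ_i ≤
D_{a_i} ≤ μ_ρ`. -/
theorem resonanceOrderAt_le_resonanceOrder (hb : IsWeightBasis ρ b a)
    (hpos : ∀ α : Fin n → ℕ, monomialWeight a α = 0 → α = 0)
    (hD : IsQuasiReinhardt ρ D) (h0 : (0 : Fin n → ℂ) ∈ D) (hbdd : Bornology.IsBounded D)
    (i : Fin n) : resonanceOrderAt a i ≤ resonanceOrder ρ D := by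
  obtain ⟨hne, hmin⟩ := minDeg_weight_eq_one hb hpos hD h0 hbdd i
  have h1 : maxDeg ρ D (a i) ≤ resonanceOrder ρ D := by
    refine le_csSup ?_ ⟨a i, hne, hmin, rfl⟩
    refine (((finite_setOf_minDeg_le hb hpos hD h0 hbdd 1).image (maxDeg ρ D)).subset
      ?_).bddAbove
    rintro _ ⟨l, hl, hlm, rfl⟩
    exact ⟨l, ⟨hl, hlm.le⟩, rfl⟩
  refine le_trans ?_ h1
  classical
  refine csSup_le ⟨_, Pi.single i 1,
    (monomialWeight_eq_iff_mem_resonanceSet _ i).1 (monomialWeight_single i), rfl⟩ ?_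
  rintro _ ⟨α, hα, rfl⟩
  refine le_csSup (bddAbove_weightDegrees hb hpos hD h0 hbdd _) ?_
  rw [← (monomialWeight_eq_iff_mem_resonanceSet α i).2 hα]
  exact sum_mem_weightDegrees hb hpos hD h0 hbdd α

/-- The components of an automorphism fixing the origin are polynomials of degree at most the
quasi-resonance order. -/
theorem exists_component_eq_eval (hρ : Continuous ρ) (hb : IsWeightBasis ρ b a)
    (hpos : ∀ α : Fin n → ℕ, monomialWeight a α = 0 → α = 0)
    (hD : IsQuasiReinhardt ρ D) (h0 : (0 : Fin n → ℂ) ∈ D) (hbdd : Bornology.IsBounded D)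
    {f : (Fin n → ℂ) → (Fin n → ℂ)} (hf : IsAutomorphism D f) (hf0 : f 0 = 0) (i : Fin n) :
    ∃ p : MvPolynomial (Fin n) ℂ, (∀ z ∈ D, b.equivFun (f z) i = MvPolynomial.eval z p) ∧
      p.totalDegree ≤ quasiResonanceOrderAt ρ D a i := by
  set φ : (Fin n → ℂ) → ℂ := fun z => b.equivFun (f z) i with hφ
  have hφd : DifferentiableOn ℂ φ D := (differentiable_coord i).comp_differentiableOn hf.1
  choose p hp hpφ using fun k => exists_weightPoly_weightPart hρ hb hpos hD h0 hφd k
  set m := resonanceOrderAt a i with hm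
  have hfin := finite_setOf_minDeg_le hb hpos hD h0 hbdd m
  -- For `k` outside the finite set, `V_k = 0` or `d_k > m`; either way no monomial of weight `k`
  -- has degree at most `m`.
  have hvanish : ∀ k ∉ hfin.toFinset, p k = 0 := by
    intro k hk
    have hk' : ∀ α, monomialWeight a α = k → m + 1 ≤ ∑ l, α l := by
      intro α hα
      by_contra! hlt
      have h1 := sum_mem_weightDegrees hb hpos hD h0 hbdd α
      rw [hα] at h1
      exact hk (hfin.mem_toFinset.2 ⟨⟨_, h1⟩, (Nat.sInf_le h1).trans (Nat.lt_succ_iff.1 hlt)⟩)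
    refine eq_of_eval_eq_on hD.isOpen h0 fun z hz => ?_
    rw [← hpφ k z hz, map_zero]
    exact weightPart_component_eq_zero hρ hb hpos hD h0 hbdd hf hf0
      (fun α hα => sum_le_resonanceOrderAt hpos hα) hk' z hz
  refine ⟨∑ k ∈ hfin.toFinset, p k,
    fun z hz => eq_sum_weightPart hρ hb hD hφd hp hpφ hvanish hz, ?_⟩
  refine MvPolynomial.totalDegree_finsetSum_le fun k hk => ?_
  obtain ⟨hne, hmin⟩ := hfin.mem_toFinset.1 hk
  refine le_trans ?_ (maxDeg_le_maxDegUpTo hb hpos hD h0 hbdd hne hmin)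
  rcases eq_or_ne (p k) 0 with h | h
  · simp [h]
  · exact le_csSup (bddAbove_weightDegrees hb hpos hD h0 hbdd k)
      ((mem_weightDegrees_iff hb hpos hD h0 hbdd k _).2 ⟨p k, hp k, h, rfl⟩)

/-- A polynomial in the standard coordinates is a polynomial of no larger degree in the
coordinates with respect to any basis. -/
theorem exists_eval_equivFun_eq (b : Module.Basis (Fin n) ℂ (Fin n → ℂ))
    (p : MvPolynomial (Fin n) ℂ) :
    ∃ P : MvPolynomial (Fin n) ℂ, (∀ z, MvPolynomial.eval z p =
      MvPolynomial.eval (b.equivFun z) P) ∧ P.totalDegree ≤ p.totalDegree := by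
  -- The `j`-th standard coordinate as a linear form in the coordinates of `b`, to be substituted
  -- into `p`.
  let L : Fin n → MvPolynomial (Fin n) ℂ := fun j =>
    ∑ i, MvPolynomial.C (b i j) * MvPolynomial.X i
  have hL : ∀ j z, MvPolynomial.eval (b.equivFun z) (L j) = z j := by
    intro j z
    conv_rhs => rw [← b.sum_equivFun z]
    simp [L, Finset.sum_apply, mul_comm]
  have hLdeg : ∀ j, (L j).totalDegree ≤ 1 := by
    intro j
    refine MvPolynomial.totalDegree_finsetSum_le fun i _ => ?_
    refine (MvPolynomial.totalDegree_mul _ _).trans ?_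
    simp
  refine ⟨∑ d ∈ p.support, MvPolynomial.C (p.coeff d) * ∏ j, L j ^ d j, fun z => ?_, ?_⟩
  · rw [MvPolynomial.eval_eq', map_sum]
    refine Finset.sum_congr rfl fun d _ => ?_
    simp only [map_mul, MvPolynomial.eval_C, map_prod, map_pow, hL]
  · refine MvPolynomial.totalDegree_finsetSum_le fun d hd => ?_
    refine (MvPolynomial.totalDegree_mul _ _).trans ?_
    rw [MvPolynomial.totalDegree_C, zero_add]
    refine (MvPolynomial.totalDegree_finsetProd _ _).trans ?_
    calc ∑ j, (L j ^ d j).totalDegree ≤ ∑ j, d j := by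
          refine Finset.sum_le_sum fun j _ => (MvPolynomial.totalDegree_pow _ _).trans ?_
          simpa using Nat.mul_le_mul_left (d j) (hLdeg j)
      _ = d.sum fun _ e => e := by rw [Finsupp.sum_fintype _ _ fun _ => rfl]
      _ ≤ p.totalDegree := MvPolynomial.le_totalDegree hd

end Degrees

end QuasiReinhardt

/-! ### The main theorem. -/

theorem theorem6p2 {r n : ℕ}
    (ρ : QuasiReinhardt.Torus r →* Matrix.GeneralLinearGroup (Fin n) ℂ)
    (hρ : Continuous ρ) (hinv : QuasiReinhardt.OnlyConstantInvariants ρ)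
    (D : Set (Fin n → ℂ)) (hD : QuasiReinhardt.IsQuasiReinhardt ρ D)
    (hbdd : Bornology.IsBounded D) (h0 : (0 : Fin n → ℂ) ∈ D)
    (f : (Fin n → ℂ) → (Fin n → ℂ)) (hf : QuasiReinhardt.IsAutomorphism D f)
    (hf0 : f 0 = 0) :
    -- coordinates in which the action is diagonal exist
    (∃ (b : Module.Basis (Fin n) ℂ (Fin n → ℂ)) (a : Fin n → Fin r → ℤ),
      QuasiReinhardt.IsWeightBasis ρ b a) ∧
    -- in any such coordinates the component `f_i` is a polynomial of degree at most `ν_i`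
    (∀ (b : Module.Basis (Fin n) ℂ (Fin n → ℂ)) (a : Fin n → Fin r → ℤ),
      QuasiReinhardt.IsWeightBasis ρ b a →
      ∀ i : Fin n, ∃ P : MvPolynomial (Fin n) ℂ,
        (∀ z ∈ D, b.equivFun (f z) i = MvPolynomial.eval (b.equivFun z) P) ∧
        P.totalDegree ≤ QuasiReinhardt.quasiResonanceOrderAt ρ D a i) ∧
    -- `f` is a polynomial map of degree at most `ν_ρ`
    (∃ P : Fin n → MvPolynomial (Fin n) ℂ,
      (∀ z ∈ D, f z = fun i => MvPolynomial.eval z (P i)) ∧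
      ∀ i, (P i).totalDegree ≤ QuasiReinhardt.quasiResonanceOrder ρ D) := by
  open QuasiReinhardt in
  refine ⟨exists_isWeightBasis hρ, fun b a hb i => ?_, ?_⟩
  · obtain ⟨p, hp, hdeg⟩ := exists_component_eq_eval hρ hb
      (eq_zero_of_monomialWeight_eq_zero hinv hb) hD h0 hbdd hf hf0 i
    obtain ⟨P, hP, hPdeg⟩ := exists_eval_equivFun_eq b p
    exact ⟨P, fun z hz => (hp z hz).trans (hP z), hPdeg.trans hdeg⟩
  · obtain ⟨b, a, hb⟩ := exists_isWeightBasis hρ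
    have hpos := eq_zero_of_monomialWeight_eq_zero hinv hb
    choose p hp hdeg using exists_component_eq_eval hρ hb hpos hD h0 hbdd hf hf0
    -- Standard components are constant linear combinations of the components in `b`, so the uniform
    -- bound `ν_i ≤ ν_ρ` passes to them.
    refine ⟨fun j => ∑ i, MvPolynomial.C (b i j) * p i, fun z hz => ?_, fun j => ?_⟩
    · funext j
      conv_lhs => rw [← b.sum_equivFun (f z)]
      simp only [Finset.sum_apply, Pi.smul_apply, smul_eq_mul, map_sum, map_mul,
        MvPolynomial.eval_C, ← hp _ z hz, mul_comm]
    · refine MvPolynomial.totalDegree_finsetSum_le fun i _ => ?_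
      refine (MvPolynomial.totalDegree_mul _ _).trans ?_
      rw [MvPolynomial.totalDegree_C, zero_add]
      exact (hdeg i).trans (maxDegUpTo_mono hb hpos hD h0 hbdd
        (resonanceOrderAt_le_resonanceOrder hb hpos hD h0 hbdd i))
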